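/- Let $b,c>0$ and let $V\in L^1_{\mathrm{loc}}(\mathbb R)$ be real-valued with $$\lim_{|x|\to\infty}\int_x^{x+1}|V(s)|\,ds=0 .$$ Let $\hat u$ denote the unitary Fourier transform on $L^2(\mathbb R)$, and let $\dot H^{1/2}(\mathbb R)$ be the completion of $H^{1/2}(\mathbb R)=\{u\in L^2(\mathbb R):|\lambda|^{1/2}\hat u\in L^2(\mathbb R)\}$ with respect to the norm $\|u\|_{\dot H^{1/2}}=\||D|^{1/2}u\|_{L^2}=\||\lambda|^{1/2}\hat u\|_{L^2}$; the map $u\mapsto|\lambda|^{1/2}\hat u$ extends to an isometry $j\colon\dot H^{1/2}(\mathbb R)\to L^2(\mathbb R)$. For $a\in\mathbb R$, $|D|^a u=w$ in $\dot H^{1/2}(\mathbb R)$ means $jw=|\lambda|^a\,ju$ almost everywhere. Let $$\mathcal L_0u=c^2|D|u+b^2|D|^{-1}u,\qquad \mathrm{dom}(\mathcal L_0)=\{u\in\dot H^{1/2}(\mathbb R):|D|u,\ |D|^{-1}u\in\dot H^{1/2}(\mathbb R)\},$$ and consider in the Hilbert space $\dot H^{1/2}(\mathbb R)$, for $u\in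 H^1(\mathbb R)\subset\dot H^{1/2}(\mathbb R)$, the forms $$\mathfrak t_0[u]=c^2\int_{\mathbb R}|u'|^2\,dx+b^2\int_{\mathbb R}|u|^2\,dx,\qquad \mathfrak q_V[u]=\int_{\mathbb R}V|u|^2\,dx,\qquad \mathfrak t_V=\mathfrak t_0+\mathfrak q_V .$$ Then: (i) The form $\mathfrak q_V$ is defined on all of $H^1(\mathbb R)$ (that is, $V|u|^2$ is integrable for every $u\in H^1(\mathbb R)$) and is infinitesimally form bounded with respect to $\mathfrak t_0$: for every $a>0$ there is $\beta>0$ such that $|\mathfrak q_V[u]|\le a\,\mathfrak t_0[u]+\beta\|u\|_{\dot H^{1/2}}^2$ for all $u\in H^1(\mathbb R)$. (ii) The form $\mathfrak t_V$, with domain $H^1(\mathbb R)$, is closed and lower semibounded in $\dot H^{1/2}(\mathbb R)$. (iii) There is a (unique) operator $\mathcal L$ in $\dot H^{1/2}(\mathbb R)$ associated with $\mathfrak t_V$, i.e. $u\in\mathrm{dom}(\mathcal L)$ and $\mathcal Lu=w$ if and only if $u\in H^1(\mathbb R)$ and $\mathfrak t_V[u,v]=(w,v)_{\dot H^{1/2}}$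 for all $v\in H^1(\mathbb R)$. It is self-adjoint, the resolvent difference $(\mathcal L-z)^{-1}-(\mathcal L_0-z)^{-1}$ is compact for every $z\in\rho(\mathcal L)\cap\rho(\mathcal L_0)$, and $$\sigma_{\mathrm{ess}}(\mathcal L)=\sigma_{\mathrm{ess}}(\mathcal L_0)=[2bc,\infty),$$ where $\sigma_{\mathrm{ess}}$ is the spectrum without the isolated eigenvalues of finite multiplicity. -/

import Mathlib

open MeasureTheory Filter Topology FourierTransform
open scoped SchwartzMap LineDeriv ComplexConjugate

noncomputable section

/-! ### Unbounded operators in a Hilbert space -/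

namespace UnboundedOp

variable {H : Type*} [NormedAddCommGroup H] [InnerProductSpace ℂ H]

/-- `R` is the bounded everywhere defined operator `(T - z)⁻¹`. -/
def IsResolventAt (T : H →ₗ.[ℂ] H) (z : ℂ) (R : H →L[ℂ] H) : Prop :=
  (∀ x : H, ∃ h : R x ∈ T.domain, T ⟨R x, h⟩ - z • R x = x) ∧
    ∀ u : T.domain, R (T u - z • (u : H)) = u

/-- The resolvent set `ρ(T)`. -/
def resolventSet (T : H →ₗ.[ℂ] H) : Set ℂ :=
  {z | ∃ R : H →L[ℂ] H, IsResolventAt T z R}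

/-- The spectrum `σ(T)`. -/
def spectrum (T : H →ₗ.[ℂ] H) : Set ℂ := (resolventSet T)ᶜ

/-- The kernel of `T - z`, as a subspace of `H`. -/
def eigenspace (T : H →ₗ.[ℂ] H) (z : ℂ) : Submodule ℂ H :=
  T.graph.comap (LinearMap.id.prod (z • LinearMap.id))

/-- The discrete spectrum: the isolated points of the spectrum that are eigenvalues of
finite multiplicity. -/
def discreteSpectrum (T : H →ₗ.[ℂ] H) : Set ℂ :=
  {z | z ∈ spectrum T ∧ ¬ AccPt z (𝓟 (spectrum T)) ∧
    eigenspace T z ≠ ⊥ ∧ FiniteDimensional ℂ (eigenspace T z)}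

/-- The essential spectrum (of a self-adjoint operator): the complement of the discrete spectrum
in the spectrum. -/
def essSpectrum (T : H →ₗ.[ℂ] H) : Set ℂ := spectrum T \ discreteSpectrum T

end UnboundedOp

/-! ### Forms in a Hilbert space -/

/-- A sesquilinear form in `H`, defined on a subspace of `H`; as for the inner product of Mathlib,
it is conjugate linear in the first argument. The quadratic form is `u ↦ t.form u u`. -/
structure SesqForm (H : Type*) [NormedAddCommGroup H] [InnerProductSpace ℂ H] where
  domain : Submodule ℂ H
  form : domain →ₗ⋆[ℂ] domain →ₗ[ℂ] ℂ

namespace SesqForm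

variable {H : Type*} [NormedAddCommGroup H] [InnerProductSpace ℂ H]

/-- The form sum, on the intersection of the two domains. -/
instance : Add (SesqForm H) where
  add s t :=
    { domain := s.domain ⊓ t.domain
      form := LinearMap.mk₂'ₛₗ (starRingEnd ℂ) (RingHom.id ℂ)
        (fun u v => s.form (Submodule.inclusion inf_le_left u) (Submodule.inclusion inf_le_left v) +
          t.form (Submodule.inclusion inf_le_right u) (Submodule.inclusion inf_le_right v))
        (fun u u' v => by simp only [map_add, LinearMap.add_apply]; ring)
        (fun a u v => by simp only [map_smul, map_smulₛₗ, LinearMap.smul_apply, smul_add])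
        (fun u v v' => by simp only [map_add]; ring)
        (fun a u v => by simp only [map_smul, RingHom.id_apply, smul_add]) }

/-- A form on a vector space `F`, regarded as a form in `H` by an injective linear map `F → H`. -/
def ofInjective {F : Type*} [AddCommGroup F] [Module ℂ F] (f : F →ₗ[ℂ] H)
    (hf : Function.Injective f) (B : F →ₗ⋆[ℂ] F →ₗ[ℂ] ℂ) : SesqForm H where
  domain := LinearMap.range f
  form := LinearMap.mk₂'ₛₗ (starRingEnd ℂ) (RingHom.id ℂ)
    (fun x y => B ((LinearEquiv.ofInjective f hf).symm x) ((LinearEquiv.ofInjective f hf).symm y))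
    (fun x x' y => by simp only [map_add, LinearMap.add_apply])
    (fun a x y => by simp only [map_smul, map_smulₛₗ, LinearMap.smul_apply])
    (fun x y y' => by simp only [map_add])
    (fun a x y => by simp only [map_smul, RingHom.id_apply])

/-- `t` is symmetric, i.e. its quadratic form is real, and `t[u] ≥ γ ‖u‖²` for some real `γ`. -/
def IsLowerSemibounded (t : SesqForm H) : Prop :=
  (∀ u v : t.domain, t.form u v = conj (t.form v u)) ∧
    ∃ γ : ℝ, ∀ u : t.domain, γ * ‖(u : H)‖ ^ 2 ≤ (t.form u u).re

/-- `t` is closed: if `uₙ ∈ dom t`, `uₙ → u` in `H` and `t[uₙ - uₘ] → 0`, then `u ∈ dom t` and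
`t[uₙ - u] → 0`. -/
def IsClosed (t : SesqForm H) : Prop :=
  ∀ (u : ℕ → t.domain) (x : H), Tendsto (fun n => (u n : H)) atTop (𝓝 x) →
    Tendsto (fun p : ℕ × ℕ => t.form (u p.1 - u p.2) (u p.1 - u p.2)) atTop (𝓝 0) →
    ∃ hx : x ∈ t.domain,
      Tendsto (fun n => t.form (u n - ⟨x, hx⟩) (u n - ⟨x, hx⟩)) atTop (𝓝 0)

/-- `q` is infinitesimally form bounded with respect to `t`: `dom t ⊆ dom q`, and for every
`a > 0` there is `β > 0` with `|q[u]| ≤ a t[u] + β ‖u‖²` for all `u ∈ dom t`. -/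
def IsInfinitesimallyBounded (q t : SesqForm H) : Prop :=
  ∃ hD : t.domain ≤ q.domain, ∀ a : ℝ, 0 < a → ∃ β : ℝ, 0 < β ∧ ∀ u : t.domain,
    ‖q.form (Submodule.inclusion hD u) (Submodule.inclusion hD u)‖
      ≤ a * (t.form u u).re + β * ‖(u : H)‖ ^ 2

/-- `T` is the operator associated with `t`: `u ∈ dom T` and `T u = w` if and only if `u ∈ dom t`
and `t[v, u] = ⟪v, w⟫` for all `v ∈ dom t`. This determines `T` uniquely. -/
def IsAssociatedOperator (t : SesqForm H) (T : H →ₗ.[ℂ] H) : Prop :=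
  ∀ u w : H, (u, w) ∈ T.graph ↔
    ∃ hu : u ∈ t.domain, ∀ v : t.domain, t.form v ⟨u, hu⟩ = inner ℂ (v : H) w

end SesqForm

/-! ### The spaces `H^{1/2}(ℝ)`, `Ḣ^{1/2}(ℝ)` and `H¹(ℝ)` -/

namespace HDot

/-- `L²(ℝ)`. -/
abbrev L2 : Type := Lp ℂ 2 (volume : Measure ℝ)

/-- The symbol of `|D|`. The Fourier transform of Mathlib is
`𝓕 u ξ = ∫ exp (-2πi x ξ) u x`, so that `D = -i d/dx` acts as multiplication by `2πξ`. In terms of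
the unitary transform `û λ = (2π)^{-1/2} ∫ exp (-i λ x) u x`, the variables are related by
`λ = 2πξ`, `û λ = (2π)^{-1/2} 𝓕 u ξ`, hence `∫ |λ| |û λ|² dλ = ∫ 2π|ξ| |𝓕 u ξ|² dξ`. -/
def absFreq (ξ : ℝ) : ℝ := 2 * Real.pi * |ξ|

/-- The function `|λ|^{1/2} û`. -/
def halfFourier (u : L2) (ξ : ℝ) : ℂ := ((absFreq ξ ^ (1 / 2 : ℝ) : ℝ) : ℂ) * (𝓕 u : L2) ξ

theorem halfFourier_add (u v : L2) :
    halfFourier (u + v) =ᵐ[volume] halfFourier u + halfFourier v := by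
  have h : (𝓕 (u + v) : L2) = 𝓕 u + 𝓕 v := FourierTransform.fourier_add u v
  filter_upwards [Lp.coeFn_add (𝓕 u : L2) (𝓕 v : L2)] with x hx
  simp only [halfFourier, h, hx, Pi.add_apply]
  ring

theorem halfFourier_smul (a : ℂ) (u : L2) :
    halfFourier (a • u) =ᵐ[volume] a • halfFourier u := by
  have h : (𝓕 (a • u) : L2) = a • 𝓕 u := FourierTransform.fourier_smul a u
  filter_upwards [Lp.coeFn_smul a (𝓕 u : L2)] with x hx
  simp only [halfFourier, h, hx, Pi.smul_apply, smul_eq_mul]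
  ring

/-- `H^{1/2}(ℝ) = {u ∈ L² : |λ|^{1/2} û ∈ L²}`, as a subspace of `L²(ℝ)`. -/
def sobolevHalf : Submodule ℂ L2 where
  carrier := {u | MemLp (halfFourier u) 2 volume}
  add_mem' {u v} hu hv := (memLp_congr_ae (halfFourier_add u v)).2 (MemLp.add hu hv)
  zero_mem' := by
    have h := halfFourier_smul 0 0
    rw [zero_smul, zero_smul] at h
    exact (memLp_congr_ae h).2 MemLp.zero
  smul_mem' a u hu := (memLp_congr_ae (halfFourier_smul a u)).2 (MemLp.const_smul hu a)

/-- `H^{1/2}(ℝ)` as a type of its own, to carry the norm `‖|λ|^{1/2} û‖_{L²}` (and not the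
norm of `L²`). -/
def HHalf : Type := sobolevHalf

instance : AddCommGroup HHalf := inferInstanceAs (AddCommGroup sobolevHalf)
instance : Module ℂ HHalf := inferInstanceAs (Module ℂ sobolevHalf)

/-- The function in `L²(ℝ)` underlying an element of `H^{1/2}(ℝ)`. -/
def HHalf.toL2 : HHalf →ₗ[ℂ] L2 := sobolevHalf.subtype

theorem HHalf.memLp (u : HHalf) : MemLp (halfFourier u.toL2) 2 volume := u.2

/-- `j₀ u = |λ|^{1/2} û`. -/
def j₀ : HHalf →ₗ[ℂ] L2 where
  toFun u := u.memLp.toLp _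
  map_add' u v := by
    rw [← MemLp.toLp_add, MemLp.toLp_eq_toLp_iff, map_add]
    exact halfFourier_add _ _
  map_smul' a u := by
    rw [RingHom.id_apply, ← MemLp.toLp_const_smul, MemLp.toLp_eq_toLp_iff, map_smul]
    exact halfFourier_smul _ _

theorem j₀_injective : Function.Injective j₀ := by
  rw [injective_iff_map_eq_zero]
  intro u hu
  have h1 : halfFourier u.toL2 =ᵐ[volume] 0 := by
    have h := u.memLp.coeFn_toLp
    have h' : u.memLp.toLp _ = (0 : L2) := hu
    rw [h'] at h
    exact h.symm.trans (Lp.coeFn_zero _ _ _)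
  have h2 : (𝓕 u.toL2 : L2) = 0 := by
    rw [Lp.eq_zero_iff_ae_eq_zero]
    have h0 : ∀ᵐ x : ℝ, x ≠ 0 := by simp [ae_iff]
    filter_upwards [h1, h0] with x hx hx0
    have hpos : 0 < absFreq x := by unfold absFreq; positivity
    have : ((absFreq x ^ (1 / 2 : ℝ) : ℝ) : ℂ) ≠ 0 := by
      exact_mod_cast (Real.rpow_pos_of_pos hpos _).ne'
    exact (mul_eq_zero.1 hx).resolve_left this
  have h3 : u.toL2 = 0 := (Lp.fourierTransformₗᵢ ℝ ℂ).map_eq_zero_iff.1 h2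
  exact Subtype.ext h3

instance : NormedAddCommGroup HHalf :=
  NormedAddCommGroup.induced HHalf L2 j₀ j₀_injective

/-- The inner product `(u, v) = (|D|^{1/2} u, |D|^{1/2} v)_{L²}`. -/
instance : InnerProductSpace ℂ HHalf where
  norm_smul_le a u := by
    change ‖j₀ (a • u)‖ ≤ ‖a‖ * ‖j₀ u‖
    rw [map_smul, norm_smul]
  inner u v := inner ℂ (j₀ u) (j₀ v)
  norm_sq_eq_re_inner u := norm_sq_eq_re_inner (𝕜 := ℂ) (j₀ u)
  conj_inner_symm u v := inner_conj_symm (j₀ u) (j₀ v)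
  add_left u v w := by rw [map_add, inner_add_left]
  smul_left u v a := by rw [map_smul, inner_smul_left]

/-- `Ḣ^{1/2}(ℝ)`: the completion of `H^{1/2}(ℝ)` with respect to the norm
`‖|D|^{1/2} u‖_{L²}`. -/
abbrev HDotHalf : Type := UniformSpace.Completion HHalf

/-- The isometry `Ḣ^{1/2}(ℝ) → L²(ℝ)` extending `j₀` by continuity. -/
def j : HDotHalf →L[ℂ] L2 :=
  (LinearIsometry.toContinuousLinearMap ⟨j₀, fun _ => rfl⟩ : HHalf →L[ℂ] L2).extend
    (UniformSpace.Completion.toComplL : HHalf →L[ℂ] HDotHalf)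

theorem j_coe (u : HHalf) : j (u : HDotHalf) = j₀ u :=
  ContinuousLinearMap.extend_eq _ UniformSpace.Completion.denseRange_coe
    (UniformSpace.Completion.isUniformInducing_coe HHalf) u

theorem norm_j (x : HDotHalf) : ‖j x‖ = ‖x‖ := by
  induction x using UniformSpace.Completion.induction_on with
  | hp => exact isClosed_eq (by fun_prop) (by fun_prop)
  | ih u => rw [j_coe, UniformSpace.Completion.norm_coe]; rfl

theorem j_injective : Function.Injective j := by
  rw [injective_iff_map_eq_zero]
  intro x hx
  rw [← norm_eq_zero, ← norm_j, hx, norm_zero]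

/-- The graph of `|D|^a` in `Ḣ^{1/2}(ℝ)`: the pairs `(u, w)` with `ŵ = |λ|^a û`, i.e. with
`j w = |λ|^a j u`. -/
def absDGraph (a : ℝ) : Submodule ℂ (HDotHalf × HDotHalf) where
  carrier := {p | j p.2 =ᵐ[volume] fun ξ => ((absFreq ξ ^ a : ℝ) : ℂ) * j p.1 ξ}
  add_mem' {p q} hp hq := by
    simp only [Set.mem_ofPred_eq, Prod.fst_add, Prod.snd_add, map_add] at hp hq ⊢
    filter_upwards [hp, hq, Lp.coeFn_add (j p.1) (j q.1), Lp.coeFn_add (j p.2) (j q.2)]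
      with x h1 h2 h3 h4
    rw [h3, h4, Pi.add_apply, Pi.add_apply, h1, h2]
    ring
  zero_mem' := by
    simp only [Set.mem_ofPred_eq, Prod.fst_zero, Prod.snd_zero, map_zero]
    filter_upwards [Lp.coeFn_zero ℂ 2 (volume : Measure ℝ)] with x h
    simp
  smul_mem' c p hp := by
    simp only [Set.mem_ofPred_eq, Prod.smul_fst, Prod.smul_snd, map_smul] at hp ⊢
    filter_upwards [hp, Lp.coeFn_smul c (j p.1), Lp.coeFn_smul c (j p.2)] with x h1 h2 h3
    rw [h2, h3, Pi.smul_apply, Pi.smul_apply, h1, smul_eq_mul, smul_eq_mul]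
    ring

/-- The operator `|D|^a` in `Ḣ^{1/2}(ℝ)`, on its maximal domain
`{u ∈ Ḣ^{1/2} : |D|^a u ∈ Ḣ^{1/2}}`. -/
def absD (a : ℝ) : HDotHalf →ₗ.[ℂ] HDotHalf := (absDGraph a).toLinearPMap

theorem mem_graph_absD (a : ℝ) (u w : HDotHalf) :
    (u, w) ∈ (absD a).graph ↔
      j w =ᵐ[volume] fun ξ => ((absFreq ξ ^ a : ℝ) : ℂ) * j u ξ := by
  rw [absD, Submodule.toLinearPMap_graph_eq]
  · rfl
  · rintro ⟨x, y⟩ hxy rfl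
    apply j_injective
    rw [map_zero, Lp.eq_zero_iff_ae_eq_zero]
    have h : j y =ᵐ[volume] fun ξ => ((absFreq ξ ^ a : ℝ) : ℂ) * j 0 ξ := hxy
    rw [map_zero] at h
    filter_upwards [h, Lp.coeFn_zero ℂ 2 (volume : Measure ℝ)] with x h1 h2
    simp [h1]

/-- The unperturbed operator `𝓛₀ u = c² |D| u + b² |D|⁻¹ u` in `Ḣ^{1/2}(ℝ)`, on its maximal domain
`{u : |D| u, |D|⁻¹ u ∈ Ḣ^{1/2}}`. -/
def opL₀ (b c : ℝ) : HDotHalf →ₗ.[ℂ] HDotHalf :=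
  ((c : ℂ) ^ 2) • absD 1 + ((b : ℂ) ^ 2) • absD (-1)

theorem toTemperedDistribution_injective :
    Function.Injective (fun u : L2 => (u : 𝓢'(ℝ, ℂ))) := by
  have h := Lp.ker_toTemperedDistributionCLM_eq_bot (F := ℂ) (μ := (volume : Measure ℝ)) (p := 2)
  exact LinearMap.ker_eq_bot.1 h

/-- `g` is the weak derivative of `u`, both in `L²(ℝ)`. -/
def IsWeakDeriv (u g : L2) : Prop := ∂_{(1 : ℝ)} (u : 𝓢'(ℝ, ℂ)) = (g : 𝓢'(ℝ, ℂ))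

theorem coe_add (u v : L2) : ((u + v : L2) : 𝓢'(ℝ, ℂ)) = (u : 𝓢'(ℝ, ℂ)) + (v : 𝓢'(ℝ, ℂ)) :=
  map_add (Lp.toTemperedDistributionCLM ℂ (volume : Measure ℝ) 2) u v

theorem coe_smul (a : ℂ) (u : L2) : ((a • u : L2) : 𝓢'(ℝ, ℂ)) = a • (u : 𝓢'(ℝ, ℂ)) :=
  map_smul (Lp.toTemperedDistributionCLM ℂ (volume : Measure ℝ) 2) a u

theorem IsWeakDeriv.add {u v g h : L2} (hu : IsWeakDeriv u g) (hv : IsWeakDeriv v h) :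
    IsWeakDeriv (u + v) (g + h) := by
  unfold IsWeakDeriv at *
  rw [coe_add, coe_add, LineDeriv.lineDerivOp_add, hu, hv]

theorem IsWeakDeriv.smul {u g : L2} (a : ℂ) (hu : IsWeakDeriv u g) :
    IsWeakDeriv (a • u) (a • g) := by
  unfold IsWeakDeriv at *
  rw [coe_smul, coe_smul, LineDeriv.lineDerivOp_smul, hu]

theorem IsWeakDeriv.unique {u g h : L2} (hg : IsWeakDeriv u g) (hh : IsWeakDeriv u h) : g = h :=
  toTemperedDistribution_injective (hg.symm.trans hh)

/-- `H¹(ℝ)`: the functions in `L²(ℝ)` whose weak derivative is in `L²(ℝ)`. -/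
def sobolevOne : Submodule ℂ L2 where
  carrier := {u | ∃ g : L2, IsWeakDeriv u g}
  add_mem' := by
    rintro u v ⟨g, hg⟩ ⟨h, hh⟩
    exact ⟨g + h, hg.add hh⟩
  zero_mem' := ⟨0, by
    have h := map_zero (Lp.toTemperedDistributionCLM ℂ (volume : Measure ℝ) 2)
    rw [Lp.toTemperedDistributionCLM_apply] at h
    rw [IsWeakDeriv, h]
    exact map_zero (LineDeriv.lineDerivOpCLM ℂ 𝓢'(ℝ, ℂ) (1 : ℝ))⟩
  smul_mem' := by
    rintro a u ⟨g, hg⟩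
    exact ⟨a • g, hg.smul a⟩

/-- The weak derivative `u ↦ u'` from `H¹(ℝ)` to `L²(ℝ)`. -/
def weakDeriv : sobolevOne →ₗ[ℂ] L2 where
  toFun u := u.2.choose
  map_add' u v := (u + v).2.choose_spec.unique (u.2.choose_spec.add v.2.choose_spec)
  map_smul' a u := (a • u).2.choose_spec.unique (u.2.choose_spec.smul a)

theorem weakDeriv_spec (u : sobolevOne) : IsWeakDeriv (u : L2) (weakDeriv u) := u.2.choose_spec

/-- `(u')^ = iλ û` for a weak derivative, in absolute value. -/
theorem norm_fourier_of_isWeakDeriv {u g : L2} (h : IsWeakDeriv u g) :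
    ∀ᵐ ξ : ℝ, ‖(𝓕 g : L2) ξ‖ = absFreq ξ * ‖(𝓕 u : L2) ξ‖ := by
  set k : ℝ → ℂ := fun ξ => (((1 + ‖ξ‖ ^ 2) ^ (-1 / 2 : ℝ) : ℝ) : ℂ) with hk
  set l : ℝ → ℂ := fun ξ => ((inner ℝ ξ (1 : ℝ) : ℝ) : ℂ) with hl
  have hkt : k.HasTemperateGrowth := by fun_prop
  have hlt : l.HasTemperateGrowth := by fun_prop
  have hk1 : ∀ ξ : ℝ, 0 < (1 + ‖ξ‖ ^ 2) ^ (-1 / 2 : ℝ) := fun ξ => by positivity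
  have hsq : ∀ ξ : ℝ, (1 + ‖ξ‖ ^ 2) ^ (-1 / 2 : ℝ) = (√(1 + ‖ξ‖ ^ 2))⁻¹ := fun ξ => by
    rw [Real.sqrt_eq_rpow, ← Real.rpow_neg (by positivity)]
    norm_num
  have hkb : MemLp k ⊤ volume := by
    refine memLp_top_of_bound hkt.1.continuous.aestronglyMeasurable 1 (ae_of_all _ fun ξ => ?_)
    rw [hk, Complex.norm_real, Real.norm_of_nonneg (hk1 ξ).le]
    exact Real.rpow_le_one_of_one_le_of_nonpos (by nlinarith [sq_nonneg ‖ξ‖]) (by norm_num)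
  have hlb : MemLp (l * k) ⊤ volume := by
    refine memLp_top_of_bound (hlt.1.continuous.mul hkt.1.continuous).aestronglyMeasurable 1
      (ae_of_all _ fun ξ => ?_)
    rw [Pi.mul_apply, norm_mul, hk, hl, Complex.norm_real, Complex.norm_real,
      Real.norm_of_nonneg (hk1 ξ).le, hsq, ← div_eq_mul_inv, div_le_one (by positivity)]
    refine Real.le_sqrt_of_sq_le ?_
    simp
  have h1 : (2 * Real.pi * Complex.I) •
      TemperedDistribution.smulLeftCLM ℂ l ((𝓕 u : L2) : 𝓢'(ℝ, ℂ)) =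
        ((𝓕 g : L2) : 𝓢'(ℝ, ℂ)) := by
    rw [← Lp.fourier_toTemperedDistribution_eq, ← Lp.fourier_toTemperedDistribution_eq, ← h,
      TemperedDistribution.fourier_lineDerivOp_eq]
  have h2 := congrArg (TemperedDistribution.smulLeftCLM ℂ k) h1
  rw [map_smul, TemperedDistribution.smulLeftCLM_smulLeftCLM_apply hlt hkt,
    ← Lp.toTemperedDistribution_smul_eq (r := 2) (hlt.mul hkt) hlb,
    ← Lp.toTemperedDistribution_smul_eq (r := 2) hkt hkb, ← coe_smul] at h2
  have h3 := toTemperedDistribution_injective h2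
  filter_upwards [Lp.ext_iff.1 h3, Lp.coeFn_smul (2 * Real.pi * Complex.I : ℂ)
    ((hlb.toLp _ • (𝓕 u : L2) : L2)), Lp.coeFn_lpSMul (r := 2) (hlb.toLp _) (𝓕 u : L2),
    Lp.coeFn_lpSMul (r := 2) (hkb.toLp _) (𝓕 g : L2), hlb.coeFn_toLp, hkb.coeFn_toLp]
    with ξ e1 e2 e3 e4 e5 e6
  rw [e2, Pi.smul_apply, e3, e4, Pi.smul_apply', Pi.smul_apply', e5, e6, Pi.mul_apply] at e1
  have hkne : k ξ ≠ 0 := by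
    exact Complex.ofReal_ne_zero.2 (hk1 ξ).ne'
  have e7 : (𝓕 g : L2) ξ = 2 * Real.pi * Complex.I * l ξ * (𝓕 u : L2) ξ := by
    apply mul_left_cancel₀ hkne
    simp only [smul_eq_mul] at e1
    rw [← e1]
    ring
  rw [e7, hl]
  simp [absFreq, abs_of_pos Real.pi_pos]

/-- `H¹(ℝ) ⊆ H^{1/2}(ℝ)`. -/
theorem sobolevOne_le_sobolevHalf : sobolevOne ≤ sobolevHalf := by
  rintro u ⟨g, hg⟩
  have hm : AEStronglyMeasurable (halfFourier u) volume := by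
    have : Measurable fun ξ : ℝ => ((absFreq ξ ^ (1 / 2 : ℝ) : ℝ) : ℂ) := by
      unfold absFreq; fun_prop
    exact this.aestronglyMeasurable.mul (Lp.aestronglyMeasurable _)
  have hb : MemLp (fun ξ => ‖(𝓕 u : L2) ξ‖ + ‖(𝓕 g : L2) ξ‖) 2 volume :=
    (Lp.memLp (𝓕 u : L2)).norm.add (Lp.memLp (𝓕 g : L2)).norm
  refine hb.mono hm ?_
  filter_upwards [norm_fourier_of_isWeakDeriv hg] with ξ hξ
  have h0 : 0 ≤ absFreq ξ := by unfold absFreq; positivity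
  have h1 : absFreq ξ ^ (1 / 2 : ℝ) ≤ 1 + absFreq ξ := by
    rw [← Real.sqrt_eq_rpow, Real.sqrt_le_left (by positivity)]
    nlinarith
  rw [Real.norm_of_nonneg (by positivity), halfFourier, norm_mul, Complex.norm_real,
    Real.norm_of_nonneg (by positivity), hξ]
  nlinarith [mul_le_mul_of_nonneg_right h1 (norm_nonneg ((𝓕 u : L2) ξ))]

/-- The embedding of `H¹(ℝ)` into `Ḣ^{1/2}(ℝ)`. -/
def embOne : sobolevOne →ₗ[ℂ] HDotHalf :=
  (UniformSpace.Completion.toComplₗᵢ : HHalf →ₗᵢ[ℂ] HDotHalf).toLinearMap ∘ₗ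
    (Submodule.inclusion sobolevOne_le_sobolevHalf : sobolevOne →ₗ[ℂ] HHalf)

theorem embOne_injective : Function.Injective embOne :=
  (UniformSpace.Completion.toComplₗᵢ : HHalf →ₗᵢ[ℂ] HDotHalf).injective.comp
    (Submodule.inclusion_injective sobolevOne_le_sobolevHalf)

/-! ### The forms `𝔱₀`, `𝔮_V` and `𝔱_V` -/

/-- `𝔱₀[u] = c² ∫ |u'|² + b² ∫ |u|²` on `H¹(ℝ)`, as a form in `Ḣ^{1/2}(ℝ)`; the inner products
in the code are those of `L²(ℝ)`. -/
def formT₀ (b c : ℝ) : SesqForm HDotHalf :=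
  SesqForm.ofInjective embOne embOne_injective <|
    LinearMap.mk₂'ₛₗ (starRingEnd ℂ) (RingHom.id ℂ)
      (fun u v => (c : ℂ) ^ 2 * inner ℂ (weakDeriv u) (weakDeriv v) +
        (b : ℂ) ^ 2 * inner ℂ (u : L2) (v : L2))
      (fun u u' v => by simp only [map_add, Submodule.coe_add, inner_add_left]; ring)
      (fun a u v => by
        simp only [map_smul, Submodule.coe_smul, inner_smul_left, smul_eq_mul]; ring)
      (fun u v v' => by simp only [map_add, Submodule.coe_add, inner_add_right]; ring)
      (fun a u v => by
        simp only [map_smul, Submodule.coe_smul, inner_smul_right, smul_eq_mul, RingHom.id_apply]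
        ring)

theorem integrable_mul_of_sq {V : ℝ → ℝ} (hV : LocallyIntegrable V volume) {u v : L2}
    (hu : Integrable (fun x => V x * ‖u x‖ ^ 2) volume)
    (hv : Integrable (fun x => V x * ‖v x‖ ^ 2) volume) :
    Integrable (fun x => (V x : ℂ) * (conj (u x) * v x)) volume := by
  refine (hu.norm.add hv.norm).mono ?_ (ae_of_all _ fun x => ?_)
  · have h1 : AEStronglyMeasurable (fun x => (V x : ℂ)) volume :=
      Complex.continuous_ofReal.comp_aestronglyMeasurable hV.aestronglyMeasurable
    have h2 : AEStronglyMeasurable (fun x => conj (u x)) volume :=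
      Complex.continuous_conj.comp_aestronglyMeasurable (Lp.aestronglyMeasurable u)
    exact h1.mul (h2.mul (Lp.aestronglyMeasurable v))
  · simp only [Pi.add_apply, norm_mul, norm_pow, norm_norm, Complex.norm_real, RCLike.norm_conj]
    rw [← mul_add, norm_mul, norm_norm]
    refine mul_le_mul_of_nonneg_left ((?_ : _ ≤ _).trans (le_abs_self _)) (norm_nonneg _)
    nlinarith [sq_nonneg (‖u x‖ - ‖v x‖), sq_nonneg (‖u x‖ + ‖v x‖)]

/-- The functions `u ∈ H¹(ℝ)` with `∫ |V| |u|² < ∞`. -/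
def domQ (V : ℝ → ℝ) (hV : LocallyIntegrable V volume) : Submodule ℂ sobolevOne where
  carrier := {u | Integrable (fun x => V x * ‖(u : L2) x‖ ^ 2) volume}
  add_mem' {u v} hu hv := by
    refine ((hu.norm.add hv.norm).const_mul 2).mono ?_ ?_
    · exact hV.aestronglyMeasurable.mul
        ((Lp.aestronglyMeasurable ((u + v : sobolevOne) : L2)).norm.pow 2)
    · filter_upwards [Lp.coeFn_add (u : L2) (v : L2)] with x hx
      rw [Submodule.coe_add, hx]
      have h : ‖(u : L2) x + (v : L2) x‖ ^ 2 ≤ 2 * (‖(u : L2) x‖ ^ 2 + ‖(v : L2) x‖ ^ 2) := by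
        nlinarith [sq_nonneg (‖(u : L2) x‖ - ‖(v : L2) x‖), norm_add_le ((u : L2) x) ((v : L2) x),
          norm_nonneg ((u : L2) x + (v : L2) x)]
      simp only [Pi.add_apply, norm_mul, norm_pow, norm_norm]
      rw [← mul_add, norm_mul, norm_norm]
      calc ‖V x‖ * ‖(u : L2) x + (v : L2) x‖ ^ 2
          ≤ ‖V x‖ * (2 * (‖(u : L2) x‖ ^ 2 + ‖(v : L2) x‖ ^ 2)) := by gcongr
        _ = 2 * (‖V x‖ * (‖(u : L2) x‖ ^ 2 + ‖(v : L2) x‖ ^ 2)) := by ring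
        _ ≤ _ := by
          rw [Real.norm_of_nonneg (by norm_num : (0 : ℝ) ≤ 2)]
          gcongr
          exact le_abs_self _
  zero_mem' := by
    refine (integrable_zero ℝ ℝ volume).congr ?_
    filter_upwards [Lp.coeFn_zero ℂ 2 (volume : Measure ℝ)] with x hx
    simp
  smul_mem' a u hu := by
    refine (Integrable.const_mul hu (‖a‖ ^ 2)).congr ?_
    filter_upwards [Lp.coeFn_smul a (u : L2)] with x hx
    rw [Submodule.coe_smul, hx, Pi.smul_apply, norm_smul]
    ring

/-- `𝔮_V[u] = ∫ V |u|²` on `{u ∈ H¹(ℝ) : ∫ |V| |u|² < ∞}`, as a form in `Ḣ^{1/2}(ℝ)`. -/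
def formQ (V : ℝ → ℝ) (hV : LocallyIntegrable V volume) : SesqForm HDotHalf :=
  SesqForm.ofInjective (embOne ∘ₗ (domQ V hV).subtype)
    (embOne_injective.comp (domQ V hV).injective_subtype) <|
    LinearMap.mk₂'ₛₗ (starRingEnd ℂ) (RingHom.id ℂ)
      (fun u v => ∫ x, (V x : ℂ) * (conj ((u : L2) x) * (v : L2) x))
      (fun u u' v => by
        rw [← integral_add (integrable_mul_of_sq hV u.2 v.2) (integrable_mul_of_sq hV u'.2 v.2)]
        refine integral_congr_ae ?_
        filter_upwards [Lp.coeFn_add (u : L2) (u' : L2)] with x hx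
        simp only [Submodule.coe_add, hx, Pi.add_apply, map_add]
        ring)
      (fun a u v => by
        rw [smul_eq_mul, ← integral_const_mul]
        refine integral_congr_ae ?_
        filter_upwards [Lp.coeFn_smul a (u : L2)] with x hx
        simp only [Submodule.coe_smul, hx, Pi.smul_apply, smul_eq_mul, map_mul]
        ring)
      (fun u v v' => by
        rw [← integral_add (integrable_mul_of_sq hV u.2 v.2) (integrable_mul_of_sq hV u.2 v'.2)]
        refine integral_congr_ae ?_
        filter_upwards [Lp.coeFn_add (v : L2) (v' : L2)] with x hx
        simp only [Submodule.coe_add, hx, Pi.add_apply]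
        ring)
      (fun a u v => by
        rw [smul_eq_mul, ← integral_const_mul]
        refine integral_congr_ae ?_
        filter_upwards [Lp.coeFn_smul a (v : L2)] with x hx
        simp only [Submodule.coe_smul, hx, Pi.smul_apply, smul_eq_mul, RingHom.id_apply]
        ring)

/-- `𝔱_V = 𝔱₀ + 𝔮_V`. -/
def formT (b c : ℝ) (V : ℝ → ℝ) (hV : LocallyIntegrable V volume) : SesqForm HDotHalf :=
  formT₀ b c + formQ V hV

end HDot

end

noncomputable section

/-! ### Compact perturbations of bounded operators -/

section Fredholm

variable {G : Type*} [NormedAddCommGroup G] [NormedSpace ℂ G]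

/-! The proof transports everything to `L²` by the map `f ↦ u = (c²D² + b²)^{-1/2} 𝓕⁻¹ f`, which is
onto `H¹` and satisfies `𝔱₀[u] = ‖f‖²`. Read as an operator `S` into `Ḣ^{1/2}` (`opS`), it is
bounded and injective with dense range, and `S†S` is multiplication by `m = |λ| / (c²λ² + b²)`, with
values in `[0, 1/(2bc)]`. The potential becomes a bounded operator `K` with `𝔮_V[u] = ⟪f, K f⟫`.

The analytic core is that `K` is compact (`exists_compact_potential`). Point evaluation is `u(x) =
⟪eₓ, f⟫` with `eₓ ∈ L²` bounded and continuous in `x`, so for integrable `V` the operator `∫ V(x)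
|eₓ⟩⟨eₓ| dx` is a norm-convergent integral of rank-one operators. A Sobolev inequality on unit
intervals bounds its norm by a multiple of `sup_n ∫_n^{n+1} |V|` (`norm_potOp_le`), so the decay of
`V` makes the truncations converge in operator norm.

What remains is abstract: a form `t[S f, S g] = ⟪f, (1 + K) g⟫` with `K` compact and self-adjoint.
Since the range of `S†` is dense, the image of the unit ball under `K` is approximated by finitely
many vectors `S† x`, and `⟪f, S† x⟫ = ⟪S f, x⟫` is controlled by `‖S f‖`; this gives infinitesimal
boundedness, hence closedness and semiboundedness. With the pencil `P(z) = 1 + K - z S†S`, the point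
`z` is in the resolvent set exactly when `P(z)` is invertible, and the resolvent is `S P(z)⁻¹ S†`;
with `P₀(z) = 1 - z S†S`, resolvent differences contain the factor `P(z)⁻¹ K P₀(z)⁻¹` and are
compact.

For the essential spectrum, `P₀(z)` is multiplication by `1 - z m`: invertible off `[2bc, ∞)`,
injective but not invertible on it. Off the half-line, the Fredholm alternative leaves only isolated
eigenvalues of finite multiplicity. On it, an invertible `P(z)` would make the injective operator
`P₀(z) = P(z) - K` invertible too. As the half-line has no isolated points, it is the essential
spectrum. -/

theorem ContinuousLinearMap.inverse_apply_self {A : G →L[ℂ] G} (hA : IsUnit A) (f : G) :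
    Ring.inverse A (A f) = f := by
  have h := Ring.inverse_mul_cancel A hA
  exact congrArg (fun B : G →L[ℂ] G => B f) h

theorem ContinuousLinearMap.apply_inverse_self {A : G →L[ℂ] G} (hA : IsUnit A) (f : G) :
    A (Ring.inverse A f) = f := by
  have h := Ring.mul_inverse_cancel A hA
  exact congrArg (fun B : G →L[ℂ] G => B f) h

/-- The Fredholm alternative for a compact perturbation of an invertible operator. -/
theorem IsCompactOperator.isUnit_add [CompleteSpace G] {A K : G →L[ℂ] G} (hA : IsUnit A)
    (hK : IsCompactOperator K) (hinj : Function.Injective (A + K)) : IsUnit (A + K) := by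
  set T : G →L[ℂ] G := -(Ring.inverse A * K) with hT
  have hTc : IsCompactOperator T := (hK.clm_comp (Ring.inverse A)).neg
  -- With `A` factored out, the claim becomes the Riesz alternative for the compact `T = -A⁻¹K` at
  -- the value `1`.
  have hsum : A + K = A * (1 - T) := by
    ext f
    simp [hT, ContinuousLinearMap.apply_inverse_self hA]
  rcases hTc.hasEigenvalue_or_mem_resolventSet (one_ne_zero (α := ℂ)) with h | h
  · obtain ⟨f, hf⟩ := h.exists_hasEigenvector
    have hf1 : T f = f := by simpa using hf.apply_eq_smul
    refine absurd (hinj (a₁ := f) (a₂ := 0) ?_) hf.2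
    rw [hsum]
    simp [hf1]
  · rw [spectrum.mem_resolventSet_iff, map_one] at h
    rw [hsum]
    exact hA.mul h

/-- A compact perturbation of an invertible operator has a finite dimensional kernel. -/
theorem IsCompactOperator.finiteDimensional_ker_add {A K : G →L[ℂ] G} (hA : IsUnit A)
    (hK : IsCompactOperator K) : FiniteDimensional ℂ (LinearMap.ker (A + K).toLinearMap) := by
  set T : G →L[ℂ] G := -(Ring.inverse A * K) with hT
  have hTc : IsCompactOperator T := (hK.clm_comp (Ring.inverse A)).neg
  have hfix : ∀ f ∈ LinearMap.ker (A + K).toLinearMap, T f = f := by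
    intro f hf
    have h1 : A f + K f = 0 := hf
    have h2 : K f = -A f := (neg_eq_of_add_eq_zero_right h1).symm
    simp [hT, h2, ContinuousLinearMap.inverse_apply_self hA]
  have hmaps : ∀ f ∈ LinearMap.ker (A + K).toLinearMap,
      (T : G →ₗ[ℂ] G) f ∈ LinearMap.ker (A + K).toLinearMap := by
    intro f hf
    rw [ContinuousLinearMap.coe_coe, hfix f hf]
    exact hf
  have hcl : IsClosed (LinearMap.ker (A + K).toLinearMap : Set G) := (A + K).isClosed_ker
  have hc := IsCompactOperator.restrict (f := (T : G →ₗ[ℂ] G)) hTc hmaps hcl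
  refine FiniteDimensional.of_isCompactOperator_id (𝕜 := ℂ) ?_
  -- On the kernel the compact operator `T` is the identity, which is compact only in finite
  -- dimension.
  have hid : (id : LinearMap.ker (A + K).toLinearMap → _) = (T : G →ₗ[ℂ] G).restrict hmaps :=
    funext fun f => Subtype.ext (hfix f f.2).symm
  rw [hid]
  exact hc

end Fredholm

/-! ### Forms `t[S f, S g] = ⟪f, (1 + K) g⟫` with `K` compact -/

section Pencil

open ContinuousLinearMap

variable {G H : Type*} [NormedAddCommGroup G] [InnerProductSpace ℂ G] [CompleteSpace G]
  [NormedAddCommGroup H] [InnerProductSpace ℂ H] [CompleteSpace H]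

theorem ContinuousLinearMap.adjoint_injective_of_denseRange {S : G →L[ℂ] H} (hS : DenseRange S) :
    Function.Injective (adjoint S) := by
  rw [injective_iff_map_eq_zero]
  intro w hw
  refine hS.eq_zero_of_inner_left ℂ fun f => ?_
  rw [← adjoint_inner_left, hw, inner_zero_left]

omit [CompleteSpace G] in
theorem ContinuousLinearMap.denseRange_of_forall_inner {S : G →L[ℂ] H}
    (h : ∀ w : H, (∀ f, inner ℂ (S f) w = 0) → w = 0) : DenseRange S := by
  have h1 : (LinearMap.range S.toLinearMap)ᗮ = ⊥ := by
    rw [Submodule.eq_bot_iff]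
    intro w hw
    exact h w fun f => hw (S f) ⟨f, rfl⟩
  have h2 := (Submodule.dense_iff_topologicalClosure_eq_top
    (s := LinearMap.range S.toLinearMap)).2 (by rw [Submodule.topologicalClosure_eq_top_iff, h1])
  exact h2

theorem ContinuousLinearMap.denseRange_adjoint_of_injective {S : G →L[ℂ] H}
    (hS : Function.Injective S) : DenseRange (adjoint S) := by
  refine denseRange_of_forall_inner fun f hf => hS ?_
  rw [map_zero, ← inner_self_eq_zero (𝕜 := ℂ), ← adjoint_inner_left, hf]

/-- A compact operator is form bounded with respect to `S` with arbitrarily small constant. -/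
theorem IsCompactOperator.exists_norm_inner_le {S : G →L[ℂ] H} {K : G →L[ℂ] G}
    (hS : Function.Injective S) (hK : IsCompactOperator K) {ε : ℝ} (hε : 0 < ε) :
    ∃ β : ℝ, 0 < β ∧ ∀ f : G, ‖inner ℂ f (K f)‖ ≤ ε * ‖f‖ ^ 2 + β * ‖S f‖ ^ 2 := by
  -- A finite `ε/4`-net `t` of the image of the unit ball; each net point is then approximated by
  -- some `S† x`, and `⟪f, S† x⟫ = ⟪S f, x⟫` costs only a multiple of `‖S f‖`.
  have htb := ((hK.isCompact_closure_image_closedBall 1).totallyBounded).subset subset_closure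
  obtain ⟨t, htf, ht⟩ := Metric.totallyBounded_iff.1 htb (ε / 4) (by positivity)
  have hx : ∀ y : G, ∃ x : H, ‖y - adjoint S x‖ < ε / 4 := by
    intro y
    obtain ⟨x, hx⟩ := (denseRange_adjoint_of_injective hS).exists_dist_lt y
      (ε := ε / 4) (by positivity)
    exact ⟨x, by rwa [← dist_eq_norm]⟩
  choose x hx using hx
  obtain ⟨M, hM⟩ := (htf.image fun y => ‖x y‖).bddAbove
  -- The maximum with `1` keeps the bound positive, so that the final `β` is positive.
  have hM' : ∀ y ∈ t, ‖x y‖ ≤ max M 1 := fun y hy => (hM ⟨y, hy, rfl⟩).trans (le_max_left _ _)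
  have hM1 : 0 < max M 1 := lt_max_of_lt_right one_pos
  generalize max M 1 = N at hM' hM1
  have hunit : ∀ f : G, ‖f‖ = 1 → ‖inner ℂ f (K f)‖ ≤ ε / 2 + N * ‖S f‖ := by
    intro f hf
    have h1 : K f ∈ K '' Metric.closedBall 0 1 := ⟨f, by simp [hf], rfl⟩
    obtain ⟨y, hy, hfy⟩ := Set.mem_iUnion₂.1 (ht h1)
    rw [Metric.mem_ball, dist_eq_norm] at hfy
    have h2 : K f = (K f - y) + (y - adjoint S (x y)) + adjoint S (x y) := by abel
    have h3 : ‖inner ℂ f (adjoint S (x y))‖ ≤ N * ‖S f‖ := by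
      rw [adjoint_inner_right, mul_comm]
      exact (norm_inner_le_norm _ _).trans
        (mul_le_mul_of_nonneg_left (hM' y hy) (norm_nonneg _))
    have h4 : ‖inner ℂ f (K f - y)‖ ≤ ε / 4 := by
      refine (norm_inner_le_norm _ _).trans ?_
      rw [hf, one_mul]
      exact hfy.le
    have h5 : ‖inner ℂ f (y - adjoint S (x y))‖ ≤ ε / 4 := by
      refine (norm_inner_le_norm _ _).trans ?_
      rw [hf, one_mul]
      exact (hx y).le
    rw [h2, inner_add_right, inner_add_right]
    refine (norm_add₃_le).trans ?_
    linarith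
  -- This is the Young constant: `N ‖S f‖ ‖f‖ ≤ (ε/2) ‖f‖² + N²/(2ε) ‖S f‖²`. The other `ε/2` comes
  -- from the two net errors.
  refine ⟨N ^ 2 / (2 * ε), by positivity, fun f => ?_⟩
  rcases eq_or_ne f 0 with rfl | hf0
  · simp
  have hn : 0 < ‖f‖ := norm_pos_iff.2 hf0
  have h := hunit (((‖f‖⁻¹ : ℝ) : ℂ) • f) (by
    rw [norm_smul, Complex.norm_real, norm_inv, norm_norm, inv_mul_cancel₀ hn.ne'])
  rw [map_smul, map_smul, inner_smul_left, inner_smul_right, norm_smul, norm_mul, norm_mul,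
    RCLike.norm_conj, Complex.norm_real, norm_inv, norm_norm] at h
  have h1 : ‖inner ℂ f (K f)‖ ≤ ε / 2 * ‖f‖ ^ 2 + N * ‖S f‖ * ‖f‖ := by
    have h2 := mul_le_mul_of_nonneg_left h (sq_nonneg ‖f‖)
    have e1 : ‖f‖ ^ 2 * (‖f‖⁻¹ * (‖f‖⁻¹ * ‖inner ℂ f (K f)‖)) = ‖inner ℂ f (K f)‖ := by
      field_simp
    have e2 : ‖f‖ ^ 2 * (ε / 2 + N * (‖f‖⁻¹ * ‖S f‖)) = ε / 2 * ‖f‖ ^ 2 + N * ‖S f‖ * ‖f‖ := by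
      field_simp
    rwa [e1, e2] at h2
  have h3 : N * ‖S f‖ * ‖f‖ ≤ ε / 2 * ‖f‖ ^ 2 + N ^ 2 / (2 * ε) * ‖S f‖ ^ 2 := by
    have e3 : ε / 2 * ‖f‖ ^ 2 + N ^ 2 / (2 * ε) * ‖S f‖ ^ 2 - N * ‖S f‖ * ‖f‖ =
        (ε * ‖f‖ - N * ‖S f‖) ^ 2 / (2 * ε) := by
      field_simp
      ring
    have := div_nonneg (sq_nonneg (ε * ‖f‖ - N * ‖S f‖)) (by positivity : 0 ≤ 2 * ε)
    linarith
  linarith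

/-- The quadratic form of `1 + K` is bounded below relative to `S`. -/
theorem IsCompactOperator.exists_le_re_inner {S : G →L[ℂ] H} {K : G →L[ℂ] G}
    (hS : Function.Injective S) (hK : IsCompactOperator K) :
    ∃ β : ℝ, 0 < β ∧ ∀ f : G,
      1 / 2 * ‖f‖ ^ 2 ≤ (inner ℂ f (f + K f)).re + β * ‖S f‖ ^ 2 := by
  obtain ⟨β, hβ, h⟩ := hK.exists_norm_inner_le hS (ε := 1 / 2) (by norm_num)
  refine ⟨β, hβ, fun f => ?_⟩
  have h1 := h f
  have h2 : -‖inner ℂ f (K f)‖ ≤ (inner ℂ f (K f)).re :=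
    neg_le_of_abs_le (Complex.abs_re_le_norm _)
  rw [inner_add_right, Complex.add_re, inner_self_eq_norm_sq_to_K]
  have h3 : (((‖f‖ : ℝ) : ℂ) ^ 2).re = ‖f‖ ^ 2 := by norm_cast
  have h4 : ((((‖f‖ : ℝ) : ℂ) ^ 2).re) = (((RCLike.ofReal ‖f‖ : ℂ)) ^ 2).re := rfl
  rw [← h4, h3]
  linarith

/-- The bounded operator `1 + K - z S† S`. -/
def pencil (S : G →L[ℂ] H) (K : G →L[ℂ] G) (z : ℂ) : G →L[ℂ] G :=
  1 + K - z • (adjoint S ∘L S)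

theorem pencil_apply (S : G →L[ℂ] H) (K : G →L[ℂ] G) (z : ℂ) (f : G) :
    pencil S K z f = f + K f - z • adjoint S (S f) := rfl

theorem pencil_eq_add (S : G →L[ℂ] H) (K : G →L[ℂ] G) (z : ℂ) :
    pencil S K z = pencil S 0 z + K := by
  ext f
  simp only [pencil_apply, add_apply, zero_apply]
  abel

/-- The graph of the operator associated with the form `t[S f, S g] = ⟪f, (1 + K) g⟫`. -/
def assocGraph (S : G →L[ℂ] H) (K : G →L[ℂ] G) : Submodule ℂ (H × H) where
  carrier := {p | ∃ f, S f = p.1 ∧ f + K f = adjoint S p.2}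
  add_mem' := by
    rintro ⟨_, w⟩ ⟨_, w'⟩ ⟨f, rfl, hf⟩ ⟨g, rfl, hg⟩
    refine ⟨f + g, map_add _ _ _, ?_⟩
    simp only [Prod.mk_add_mk, map_add] at hf hg ⊢
    rw [← hf, ← hg]
    abel
  zero_mem' := ⟨0, by simp⟩
  smul_mem' := by
    rintro c ⟨_, w⟩ ⟨f, rfl, hf⟩
    refine ⟨c • f, map_smul _ _ _, ?_⟩
    simp only [Prod.smul_mk, map_smul] at hf ⊢
    rw [← hf, smul_add]

/-- The operator associated with the form `t[S f, S g] = ⟪f, (1 + K) g⟫`. -/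
def assocOp (S : G →L[ℂ] H) (K : G →L[ℂ] G) : H →ₗ.[ℂ] H := (assocGraph S K).toLinearPMap

variable {S : G →L[ℂ] H} {K : G →L[ℂ] G}

/-- `toLinearPMap` has the given graph only if that graph is single-valued; this follows from
injectivity of `S` and of `S†`, the latter equivalent to dense range of `S`. -/
theorem mem_graph_assocOp (hi : Function.Injective S) (hd : DenseRange S) {u w : H} :
    (u, w) ∈ (assocOp S K).graph ↔ ∃ f, S f = u ∧ f + K f = adjoint S w := by
  rw [assocOp, Submodule.toLinearPMap_graph_eq]
  · rfl
  · rintro ⟨x, y⟩ ⟨f, hf, hy⟩ rfl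
    have hf0 : f = 0 := hi (by rw [hf, map_zero])
    simp only [hf0, map_zero, add_zero] at hy
    exact adjoint_injective_of_denseRange hd (by rw [← hy, map_zero])

/-- Writing `u = S f`, the equation `(T - z) u = w` becomes `P(z) f = S† w`, so the resolvent is `S
P(z)⁻¹ S†`. -/
theorem isResolventAt_assocOp (hi : Function.Injective S) (hd : DenseRange S) {z : ℂ}
    (hz : IsUnit (pencil S K z)) :
    UnboundedOp.IsResolventAt (assocOp S K) z
      (S ∘L Ring.inverse (pencil S K z) ∘L adjoint S) := by
  constructor
  · intro w
    set f := Ring.inverse (pencil S K z) (adjoint S w) with hf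
    have h1 : pencil S K z f = adjoint S w := apply_inverse_self hz _
    rw [pencil_apply, sub_eq_iff_eq_add] at h1
    have h2 : (S f, w + z • S f) ∈ (assocOp S K).graph :=
      (mem_graph_assocOp hi hd).2 ⟨f, rfl, by rw [h1, map_add, map_smul]⟩
    obtain ⟨y, hy1, hy2⟩ := (LinearPMap.mem_graph_iff _).1 h2
    simp only at hy1 hy2
    have hm : S f ∈ (assocOp S K).domain := hy1 ▸ y.2
    refine ⟨hm, ?_⟩
    have h3 : (⟨S f, hm⟩ : (assocOp S K).domain) = y := Subtype.ext hy1.symm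
    change assocOp S K ⟨S f, hm⟩ - z • S f = w
    rw [h3, hy2, add_sub_cancel_right]
  · intro u
    obtain ⟨f, hf1, hf2⟩ := (mem_graph_assocOp hi hd).1 ((assocOp S K).mem_graph u)
    have h1 : adjoint S (assocOp S K u - z • (u : H)) = pencil S K z f := by
      rw [pencil_apply, map_sub, map_smul, ← hf2, hf1]
    simp only [comp_apply, h1, inverse_apply_self hz, hf1]

omit [CompleteSpace H] in
theorem UnboundedOp.IsResolventAt.unique {T : H →ₗ.[ℂ] H} {z : ℂ} {R R' : H →L[ℂ] H}
    (h : IsResolventAt T z R) (h' : IsResolventAt T z R') : R = R' := by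
  ext x
  obtain ⟨hx, e⟩ := h.1 x
  have := h'.2 ⟨R x, hx⟩
  rw [e] at this
  exact this.symm

omit [CompleteSpace H] in
theorem UnboundedOp.IsResolventAt.apply_of_mem_graph {T : H →ₗ.[ℂ] H} {z : ℂ} {R : H →L[ℂ] H}
    (h : IsResolventAt T z R) {u w : H} (hu : (u, w) ∈ T.graph) : R (w - z • u) = u := by
  obtain ⟨y, hy1, hy2⟩ := (LinearPMap.mem_graph_iff _).1 hu
  simp only at hy1 hy2
  rw [← hy1, ← hy2]
  exact h.2 y

omit [CompleteSpace H] in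
theorem UnboundedOp.IsResolventAt.mem_graph {T : H →ₗ.[ℂ] H} {z : ℂ} {R : H →L[ℂ] H}
    (h : IsResolventAt T z R) (x : H) : (R x, x + z • R x) ∈ T.graph := by
  obtain ⟨hx, e⟩ := h.1 x
  have := T.mem_graph ⟨R x, hx⟩
  rwa [sub_eq_iff_eq_add.1 e] at this

/-- Lax–Milgram: the lower bound for the form says that the pencil is coercive at `-β`. The
coercivity is kept in the conclusion because the density of the domain is derived from it. -/
theorem exists_isUnit_pencil (hi : Function.Injective S) (hK : IsCompactOperator K) :
    ∃ β : ℝ, IsUnit (pencil S K (-β : ℝ)) ∧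
      ∀ f, 1 / 2 * ‖f‖ ^ 2 ≤ (inner ℂ (pencil S K (-β : ℝ) f) f).re := by
  obtain ⟨β, -, h⟩ := hK.exists_le_re_inner hi
  have key : ∀ f, 1 / 2 * ‖f‖ ^ 2 ≤ (inner ℂ (pencil S K (-β : ℝ) f) f).re := by
    intro f
    refine (h f).trans (le_of_eq ?_)
    rw [pencil_apply, inner_sub_left, inner_smul_left, adjoint_inner_left,
      inner_self_eq_norm_sq_to_K, Complex.sub_re, ← inner_conj_symm (f + K f) f, Complex.conj_re,
      Complex.conj_ofReal]
    have : (((-β : ℝ) : ℂ) * (RCLike.ofReal ‖S f‖ : ℂ) ^ 2).re = -β * ‖S f‖ ^ 2 := by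
      rw [RCLike.ofReal_eq_complex_ofReal]
      norm_cast
    rw [this]
    ring
  refine ⟨β, isUnit_of_forall_le_norm_inner_map _ (c := 1 / 2) (by norm_num) fun f => ?_, key⟩
  refine le_trans (le_of_eq ?_) ((key f).trans (Complex.re_le_norm _))
  push_cast
  ring

/-- A kernel vector of `P(z)` gives an eigenvector of the operator. For surjectivity, solve `P(-β) f
= g` first; the error `P(z) f - g = -(z + β) S†S f` has the form `S† w`, and the resolvent at `z`
supplies the correction `f'`. -/
theorem UnboundedOp.IsResolventAt.isUnit_pencil (hi : Function.Injective S) (hd : DenseRange S)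
    (hK : IsCompactOperator K) {z : ℂ} {R : H →L[ℂ] H} (h : IsResolventAt (assocOp S K) z R) :
    IsUnit (pencil S K z) := by
  rw [ContinuousLinearMap.isUnit_iff_bijective]
  constructor
  · rw [injective_iff_map_eq_zero]
    intro f hf
    rw [pencil_apply, sub_eq_zero, ← map_smul] at hf
    have h1 := h.apply_of_mem_graph ((mem_graph_assocOp hi hd).2 ⟨f, rfl, hf⟩)
    rw [sub_self, map_zero] at h1
    exact hi (by rw [← h1, map_zero])
  · intro g
    obtain ⟨β, hβ, -⟩ := exists_isUnit_pencil hi hK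
    set f := Ring.inverse (pencil S K (-β : ℝ)) g with hf
    have h1 : pencil S K (-β : ℝ) f = g := apply_inverse_self hβ g
    obtain ⟨f', h2, h3⟩ := (mem_graph_assocOp hi hd).1 (h.mem_graph ((z - (-β : ℝ)) • S f))
    refine ⟨f + f', ?_⟩
    rw [← h1, map_add, pencil_apply, pencil_apply, pencil_apply, h3, ← h2]
    simp only [map_add, map_smul]
    module

/-- Second resolvent identity at the level of pencils: the difference is `-S P(z)⁻¹ K P₀(z)⁻¹ S†`,
which is compact because of the factor `K`. -/
theorem isCompactOperator_resolvent_sub (hi : Function.Injective S) (hd : DenseRange S)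
    (hK : IsCompactOperator K) {z : ℂ} {R R₀ : H →L[ℂ] H}
    (h : UnboundedOp.IsResolventAt (assocOp S K) z R)
    (h₀ : UnboundedOp.IsResolventAt (assocOp S 0) z R₀) : IsCompactOperator (R - R₀) := by
  have h1 := h.isUnit_pencil hi hd hK
  have h2 := h₀.isUnit_pencil hi hd isCompactOperator_zero
  rw [h.unique (isResolventAt_assocOp hi hd h1), h₀.unique (isResolventAt_assocOp hi hd h2)]
  have h3 : S ∘L Ring.inverse (pencil S K z) ∘L adjoint S -
      S ∘L Ring.inverse (pencil S 0 z) ∘L adjoint S =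
      -((S ∘L Ring.inverse (pencil S K z)) ∘L K ∘L (Ring.inverse (pencil S 0 z) ∘L adjoint S)) := by
    ext w
    set g := Ring.inverse (pencil S 0 z) (adjoint S w) with hg
    have e1 : adjoint S w = pencil S K z g - K g := by
      rw [pencil_eq_add, add_apply, apply_inverse_self h2, add_sub_cancel_right]
    have e2 : Ring.inverse (pencil S K z) (adjoint S w) =
        g - Ring.inverse (pencil S K z) (K g) := by
      rw [e1, map_sub, inverse_apply_self h1]
    simp only [sub_apply, comp_apply, neg_apply, e2, ← hg, map_sub]
    abel
  rw [h3]
  exact ((hK.comp_clm (Ring.inverse (pencil S 0 z) ∘L adjoint S)).clm_comp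
    (S ∘L Ring.inverse (pencil S K z))).neg

/-- A symmetric operator `T` with `T + β` onto `H` for a real `β` is self-adjoint. Only the domain
of the adjoint needs an argument, and the density of the domain of `T` has to be shown first. -/
theorem isSelfAdjoint_assocOp (hi : Function.Injective S) (hd : DenseRange S)
    (hK : IsCompactOperator K) (hKs : IsSelfAdjoint K) : IsSelfAdjoint (assocOp S K) := by
  obtain ⟨β, hβ, hcoer⟩ := exists_isUnit_pencil hi hK
  have hres := isResolventAt_assocOp hi hd hβ
  have hdense : Dense ((assocOp S K).domain : Set H) := by
    rw [Submodule.dense_iff_topologicalClosure_eq_top, Submodule.topologicalClosure_eq_top_iff,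
      Submodule.eq_bot_iff]
    intro x hx
    obtain ⟨hm, -⟩ := hres.1 x
    set f := Ring.inverse (pencil S K (-β : ℝ)) (adjoint S x) with hf
    have h2 : pencil S K (-β : ℝ) f = adjoint S x := apply_inverse_self hβ _
    -- A vector `x` orthogonal to the domain is orthogonal to its own resolvent image `S f`;
    -- coercivity then forces `f = 0`, hence `S† x = 0` and `x = 0`.
    have h1 : inner ℂ f (adjoint S x) = 0 := by
      rw [adjoint_inner_right]
      exact hx _ hm
    have h3 := hcoer f
    rw [h2, ← inner_conj_symm, h1, map_zero, Complex.zero_re] at h3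
    have h4 : f = 0 := by
      rw [← norm_eq_zero]
      nlinarith [norm_nonneg f]
    rw [h4, map_zero] at h2
    exact adjoint_injective_of_denseRange hd (by rw [← h2, map_zero])
  have hsymm : (assocOp S K).IsFormalAdjoint (assocOp S K) := by
    intro x y
    obtain ⟨f, hf1, hf2⟩ := (mem_graph_assocOp hi hd).1 ((assocOp S K).mem_graph x)
    obtain ⟨g, hg1, hg2⟩ := (mem_graph_assocOp hi hd).1 ((assocOp S K).mem_graph y)
    rw [← hf1, ← hg1, ← adjoint_inner_left S g, ← adjoint_inner_right S f, ← hf2, ← hg2,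
      inner_add_left, inner_add_right, ← adjoint_inner_right K f g, hKs.adjoint_eq]
  have hle := hsymm.le_adjoint hdense
  rw [LinearPMap.isSelfAdjoint_def]
  refine le_antisymm ?_ hle
  have hdom : (assocOp S K).adjoint.domain ≤ (assocOp S K).domain := by
    intro y hy
    set w : H := (assocOp S K).adjoint ⟨y, hy⟩ with hw
    obtain ⟨hm, e⟩ := hres.1 (w - ((-β : ℝ) : ℂ) • y)
    -- Here `v` solves `(T + β) v = (T* + β) y`, so `y - v` is orthogonal to the range of `T + β`.
    -- That range is all of `H`; the vector `x` below is chosen with `(T + β) x = y - v`.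
    set v := (S ∘L Ring.inverse (pencil S K (-β : ℝ)) ∘L adjoint S) (w - ((-β : ℝ) : ℂ) • y)
      with hv
    suffices hyv : y = v by rw [hyv]; exact hm
    rw [← sub_eq_zero]
    refine (inner_self_eq_zero (𝕜 := ℂ)).1 ?_
    obtain ⟨hm', e'⟩ := hres.1 (y - v)
    set x : (assocOp S K).domain := ⟨_, hm'⟩ with hx
    have h1 : inner ℂ w (x : H) = inner ℂ y (assocOp S K x) :=
      LinearPMap.adjoint_isFormalAdjoint hdense ⟨y, hy⟩ x
    have h2 : inner ℂ (assocOp S K ⟨v, hm⟩) (x : H) = inner ℂ v (assocOp S K x) :=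
      hsymm ⟨v, hm⟩ x
    have e'' : assocOp S K x - ((-β : ℝ) : ℂ) • (x : H) = y - v := e'
    have e2 : assocOp S K ⟨v, hm⟩ = w - ((-β : ℝ) : ℂ) • y + ((-β : ℝ) : ℂ) • v :=
      sub_eq_iff_eq_add.1 e
    rw [e2] at h2
    simp only [inner_add_left, inner_sub_left, inner_smul_left, Complex.conj_ofReal] at h2
    have h3 : inner ℂ (y - v) (assocOp S K x - ((-β : ℝ) : ℂ) • (x : H)) = 0 := by
      simp only [inner_sub_left, inner_sub_right, inner_smul_right]
      rw [← h1, ← h2]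
      ring
    rwa [e''] at h3
  exact ⟨hdom, fun x y hxy => ((hle.2 (x := y) (y := x) hxy.symm)).symm⟩

end Pencil

/-! ### Spectrum, eigenspaces and Weyl's theorem in terms of the pencil. -/

section Pencil

open ContinuousLinearMap

variable {G H : Type*} [NormedAddCommGroup G] [InnerProductSpace ℂ G] [CompleteSpace G]
  [NormedAddCommGroup H] [InnerProductSpace ℂ H] [CompleteSpace H]
  {S : G →L[ℂ] H} {K : G →L[ℂ] G}

theorem mem_resolventSet_assocOp (hi : Function.Injective S) (hd : DenseRange S)
    (hK : IsCompactOperator K) {z : ℂ} :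
    z ∈ UnboundedOp.resolventSet (assocOp S K) ↔ IsUnit (pencil S K z) :=
  ⟨fun ⟨_, hR⟩ => hR.isUnit_pencil hi hd hK, fun h => ⟨_, isResolventAt_assocOp hi hd h⟩⟩

theorem eigenspace_assocOp (hi : Function.Injective S) (hd : DenseRange S) (z : ℂ) :
    UnboundedOp.eigenspace (assocOp S K) z =
      (LinearMap.ker (pencil S K z).toLinearMap).map S.toLinearMap := by
  ext u
  change (u, z • u) ∈ (assocOp S K).graph ↔ _
  rw [mem_graph_assocOp hi hd, Submodule.mem_map]
  refine exists_congr fun f => ?_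
  rw [LinearMap.mem_ker, coe_coe, coe_coe, pencil_apply, sub_eq_zero, and_comm]
  refine and_congr_left fun h => ?_
  rw [h, map_smul]

/-- Eigenvectors for different eigenvalues are orthogonal. -/
theorem inner_eq_zero_of_pencil_eq_zero (hKs : IsSelfAdjoint K)
    {z z' : ℂ} (hz : z ≠ z') {f g : G} (hf : pencil S K z f = 0) (hg : pencil S K z' g = 0) :
    inner ℂ (S f) (S g) = 0 := by
  have key : ∀ {a a' : ℂ} {f g : G}, pencil S K a f = 0 → pencil S K a' g = 0 →
      conj a * inner ℂ (S f) (S g) = a' * inner ℂ (S f) (S g) := by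
    intro a a' f g hf hg
    rw [pencil_apply, sub_eq_zero] at hf hg
    have h1 : inner ℂ (f + K f) g = inner ℂ f (g + K g) := by
      rw [inner_add_left, inner_add_right, ← adjoint_inner_right K f g, hKs.adjoint_eq]
    rwa [hf, hg, inner_smul_left, inner_smul_right, adjoint_inner_left, adjoint_inner_right] at h1
  by_contra hne
  have h1 := mul_right_cancel₀ hne (key hf hg)
  have hf0 : inner ℂ (S f) (S f) ≠ 0 := by
    intro h
    rw [inner_self_eq_zero] at h
    rw [h, inner_zero_left] at hne
    exact hne rfl
  -- Taking the same vector twice shows that `z` is real, so `conj z = z'` reads `z = z'`.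
  have h2 := mul_right_cancel₀ hf0 (key hf hf)
  exact hz (h2.symm.trans h1)

/-- The zeros of the pencil do not accumulate at a point where the unperturbed pencil is
invertible. -/
theorem not_accPt_pencil (hi : Function.Injective S) (hK : IsCompactOperator K)
    (hKs : IsSelfAdjoint K) {z : ℂ} (hz : IsUnit (pencil S 0 z)) {s : Set ℂ}
    (hs : ∀ᶠ w in 𝓝 z, w ∈ s → ∃ f, f ≠ 0 ∧ pencil S K w f = 0) : ¬ AccPt z (𝓟 s) := by
  intro hacc
  rw [accPt_principal_iff_clusterPt] at hacc
  obtain ⟨x, hxs, hx⟩ := mem_closure_iff_seq_limit.1 (mem_closure_iff_clusterPt.2 hacc)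
  obtain ⟨N, hN⟩ := eventually_atTop.1 (hx.eventually hs)
  -- Suppose parameters `xₙ ≠ z` tend to `z`, with unit vectors in the kernels of the pencils.
  -- Compactness of `K` yields a limit vector in the kernel at `z`, and orthogonality of
  -- eigenvectors will make it vanish.
  have hex : ∀ n, ∃ f : G, ‖f‖ = 1 ∧ pencil S K (x (n + N)) f = 0 := by
    intro n
    obtain ⟨f, hf0, hf⟩ := hN (n + N) (by omega) (hxs _).1
    have hn : ‖f‖ ≠ 0 := norm_ne_zero_iff.2 hf0
    refine ⟨((‖f‖⁻¹ : ℝ) : ℂ) • f, ?_, by rw [map_smul, hf, smul_zero]⟩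
    rw [norm_smul, Complex.norm_real, norm_inv, norm_norm, inv_mul_cancel₀ hn]
  choose f hf1 hf using hex
  have hx' : Tendsto (fun n => x (n + N)) atTop (𝓝 z) := (tendsto_add_atTop_iff_nat N).2 hx
  obtain ⟨C, hC, hCK⟩ := hK.image_closedBall_subset_compact (f := (K : G →ₗ[ℂ] G)) 1
  obtain ⟨y, -, ψ, hψ, hy⟩ := hC.tendsto_subseq fun n => hCK ⟨f n, by simp [hf1], rfl⟩
  -- This solves `P(xₙ) fₙ = 0` for `fₙ` through the invertible `P₀(z)`, so that convergence of `K
  -- fₙ` along a subsequence forces that of `fₙ`.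
  have heq : ∀ n, f n = Ring.inverse (pencil S 0 z)
      ((x (n + N) - z) • adjoint S (S (f n)) - K (f n)) := by
    intro n
    have h1 := hf n
    rw [pencil_apply, sub_eq_zero] at h1
    have h2 : pencil S 0 z (f n) = (x (n + N) - z) • adjoint S (S (f n)) - K (f n) := by
      rw [pencil_apply, zero_apply, add_zero, sub_smul, ← h1]
      abel
    rw [← h2, inverse_apply_self hz]
  have hsmall : Tendsto (fun n => (x (n + N) - z) • adjoint S (S (f n))) atTop (𝓝 0) := by
    rw [tendsto_zero_iff_norm_tendsto_zero]
    have h0 : Tendsto (fun n => ‖x (n + N) - z‖ * (‖adjoint S‖ * ‖S‖)) atTop (𝓝 0) := by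
      have h1 := (tendsto_iff_norm_sub_tendsto_zero.1 hx').mul_const (‖adjoint S‖ * ‖S‖)
      rwa [zero_mul] at h1
    refine squeeze_zero (fun _ => norm_nonneg _) (fun n => ?_) h0
    rw [norm_smul]
    gcongr
    refine ((adjoint S).le_opNorm _).trans ?_
    gcongr
    simpa [hf1] using S.le_opNorm (f n)
  set F := Ring.inverse (pencil S 0 z) (0 - y) with hF
  have hlim : Tendsto (fun n => f (ψ n)) atTop (𝓝 F) := by
    have h1 := ((Ring.inverse (pencil S 0 z)).continuous.tendsto (0 - y)).comp
      ((hsmall.comp hψ.tendsto_atTop).sub hy)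
    refine h1.congr fun n => ?_
    exact (heq (ψ n)).symm
  have hF1 : ‖F‖ = 1 := tendsto_nhds_unique hlim.norm (by simp [hf1])
  have hKF : y = K F := tendsto_nhds_unique hy ((K.continuous.tendsto F).comp hlim)
  have hPF : pencil S K z F = 0 := by
    have h1 : pencil S 0 z F = 0 - y := apply_inverse_self hz _
    rw [pencil_eq_add, add_apply, h1, hKF]
    abel
  -- The vector `F` belongs to the parameter `z` and each `fₙ` to some `xₙ ≠ z`. In the limit `S F`
  -- is orthogonal to itself, so `F = 0` although `‖F‖ = 1`.
  have horth : ∀ n, inner ℂ (S (f (ψ n))) (S F) = 0 := fun n =>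
    inner_eq_zero_of_pencil_eq_zero hKs (hxs _).2 (hf _) hPF
  have hSF : inner ℂ (S F) (S F) = 0 := by
    refine tendsto_nhds_unique (f := fun n => inner ℂ (S (f (ψ n))) (S F))
      (((S.continuous.tendsto F).comp hlim).inner tendsto_const_nhds) ?_
    simp [horth]
  rw [inner_self_eq_zero] at hSF
  have : F = 0 := hi (by rw [hSF, map_zero])
  rw [this, norm_zero] at hF1
  exact zero_ne_one hF1

/-- Weyl's theorem: if the unperturbed operator has no eigenvalues and its spectrum is closed and
has no isolated points, then that spectrum is the essential spectrum of the perturbed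
operator. -/
theorem essSpectrum_assocOp (hi : Function.Injective S) (hd : DenseRange S)
    (hK : IsCompactOperator K) (hKs : IsSelfAdjoint K) {σ : Set ℂ} (hcl : IsClosed σ)
    (hacc : ∀ z ∈ σ, AccPt z (𝓟 σ)) (hunit : ∀ z ∉ σ, IsUnit (pencil S 0 z))
    (hinj : ∀ z, Function.Injective (pencil S 0 z)) (hnot : ∀ z ∈ σ, ¬ IsUnit (pencil S 0 z)) :
    UnboundedOp.essSpectrum (assocOp S K) = σ := by
  have hspec : ∀ z, z ∈ UnboundedOp.spectrum (assocOp S K) ↔ ¬ IsUnit (pencil S K z) := fun z => by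
    rw [UnboundedOp.spectrum, Set.mem_compl_iff, mem_resolventSet_assocOp hi hd hK]
  have hsub : σ ⊆ UnboundedOp.spectrum (assocOp S K) := by
    intro z hz
    rw [hspec]
    intro hu
    -- The Fredholm alternative is used backwards: the unperturbed pencil is a compact perturbation
    -- of the perturbed one, and it is injective.
    have h1 : pencil S 0 z = pencil S K z + -K := by rw [pencil_eq_add S K]; abel
    refine hnot z hz ?_
    rw [h1]
    refine IsCompactOperator.isUnit_add hu hK.neg ?_
    rw [← h1]
    exact hinj z
  have hker : ∀ z ∉ σ, z ∈ UnboundedOp.spectrum (assocOp S K) →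
      ∃ f, f ≠ 0 ∧ pencil S K z f = 0 := by
    intro z hz hzs
    rw [hspec] at hzs
    by_contra! hno
    refine hzs ?_
    rw [pencil_eq_add]
    refine IsCompactOperator.isUnit_add (hunit z hz) hK ?_
    rw [← pencil_eq_add, injective_iff_map_eq_zero]
    intro f hf
    by_contra hf0
    exact hno f hf0 hf
  apply Set.Subset.antisymm
  · rintro z ⟨hzs, hzd⟩
    by_contra hz
    refine hzd ⟨hzs, ?_, ?_, ?_⟩
    · refine not_accPt_pencil hi hK hKs (hunit z hz) ?_
      filter_upwards [hcl.isOpen_compl.mem_nhds hz] with w hw hws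
      exact hker w hw hws
    · obtain ⟨f, hf0, hf⟩ := hker z hz hzs
      rw [eigenspace_assocOp hi hd, Submodule.ne_bot_iff]
      refine ⟨S f, ⟨f, hf, rfl⟩, fun h => hf0 (hi ?_)⟩
      rw [h, map_zero]
    · rw [eigenspace_assocOp hi hd, pencil_eq_add]
      have := IsCompactOperator.finiteDimensional_ker_add (hunit z hz) hK
      infer_instance
  · intro z hz
    refine ⟨hsub hz, fun h => h.2.1 ?_⟩
    -- A point of `σ` is never isolated in `σ`, hence not isolated in the larger perturbed spectrum.
    exact (hacc z hz).mono (principal_mono.2 hsub)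

end Pencil

/-! ### Forms -/

namespace SesqForm

open ContinuousLinearMap

variable {G H : Type*} [NormedAddCommGroup G] [InnerProductSpace ℂ G] [CompleteSpace G]
  [NormedAddCommGroup H] [InnerProductSpace ℂ H] [CompleteSpace H]

/-- The form has domain `range S` and satisfies `t[S f, S g] = ⟪f, (1 + K) g⟫`. -/
structure IsPencilForm (t : SesqForm H) (S : G →L[ℂ] H) (K : G →L[ℂ] G) : Prop where
  mem_domain : ∀ f, S f ∈ t.domain
  exists_eq : ∀ u ∈ t.domain, ∃ f, S f = u
  form_eq : ∀ f g, t.form ⟨S f, mem_domain f⟩ ⟨S g, mem_domain g⟩ = inner ℂ f (g + K g)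

namespace IsPencilForm

variable {t : SesqForm H} {S : G →L[ℂ] H} {K : G →L[ℂ] G}

omit [CompleteSpace G] [CompleteSpace H] in
theorem exists_eq_mk (ht : t.IsPencilForm S K) (u : t.domain) :
    ∃ f, u = ⟨S f, ht.mem_domain f⟩ := by
  obtain ⟨f, hf⟩ := ht.exists_eq u u.2
  exact ⟨f, Subtype.ext hf.symm⟩

theorem isAssociatedOperator (ht : t.IsPencilForm S K) (hi : Function.Injective S)
    (hd : DenseRange S) : t.IsAssociatedOperator (assocOp S K) := by
  intro u w
  rw [mem_graph_assocOp hi hd]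
  constructor
  · rintro ⟨f, rfl, hf⟩
    refine ⟨ht.mem_domain f, fun v => ?_⟩
    obtain ⟨g, rfl⟩ := ht.exists_eq_mk v
    rw [ht.form_eq, hf, adjoint_inner_right]
  · rintro ⟨hu, h⟩
    obtain ⟨f, rfl⟩ := ht.exists_eq u hu
    refine ⟨f, rfl, ext_inner_left ℂ fun g => ?_⟩
    rw [← ht.form_eq, adjoint_inner_right]
    exact h ⟨S g, ht.mem_domain g⟩

theorem isLowerSemibounded (ht : t.IsPencilForm S K) (hi : Function.Injective S)
    (hK : IsCompactOperator K) (hKs : IsSelfAdjoint K) : t.IsLowerSemibounded := by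
  constructor
  · intro u v
    obtain ⟨f, rfl⟩ := ht.exists_eq_mk u
    obtain ⟨g, rfl⟩ := ht.exists_eq_mk v
    rw [ht.form_eq, ht.form_eq, inner_conj_symm, inner_add_left, inner_add_right,
      ← adjoint_inner_right K f g, hKs.adjoint_eq]
  · obtain ⟨β, -, h⟩ := hK.exists_le_re_inner hi
    refine ⟨-β, fun u => ?_⟩
    obtain ⟨f, rfl⟩ := ht.exists_eq_mk u
    rw [ht.form_eq]
    have := h f
    nlinarith [sq_nonneg ‖f‖]

/-- The form controls `‖f‖²` up to a multiple of `‖S f‖²`, so a form-Cauchy sequence that converges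
in `H` lifts to a Cauchy sequence in `G`. Its limit there gives the limit in the form sense. -/
theorem isClosed (ht : t.IsPencilForm S K) (hi : Function.Injective S)
    (hK : IsCompactOperator K) : t.IsClosed := by
  intro u x hux hform
  choose f hf using fun n => ht.exists_eq_mk (u n)
  have hsub : ∀ g h, (⟨S g, ht.mem_domain g⟩ - ⟨S h, ht.mem_domain h⟩ : t.domain) =
      ⟨S (g - h), ht.mem_domain _⟩ := fun g h => Subtype.ext (map_sub S g h).symm
  obtain ⟨β, -, hβ⟩ := hK.exists_le_re_inner hi
  simp only [hf, hsub, ht.form_eq] at hform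
  simp only [hf] at hux
  have h1 : Tendsto (fun p : ℕ × ℕ => ‖S (f p.1 - f p.2)‖) atTop (𝓝 0) := by
    have h := hux.cauchySeq
    rw [cauchySeq_iff_tendsto_dist_atTop_0] at h
    refine h.congr fun p => ?_
    rw [dist_eq_norm, map_sub]
  have h2 : Tendsto (fun p : ℕ × ℕ => ‖f p.1 - f p.2‖) atTop (𝓝 0) := by
    have h3 : Tendsto (fun p : ℕ × ℕ => 2 *
        ((inner ℂ (f p.1 - f p.2) (f p.1 - f p.2 + K (f p.1 - f p.2))).re +
          β * ‖S (f p.1 - f p.2)‖ ^ 2)) atTop (𝓝 0) := by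
      have h4 := (((Complex.continuous_re.tendsto 0).comp hform).add
        ((h1.pow 2).const_mul β)).const_mul 2
      simpa using h4
    have h5 : Tendsto (fun p : ℕ × ℕ => ‖f p.1 - f p.2‖ ^ 2) atTop (𝓝 0) :=
      squeeze_zero (fun _ => sq_nonneg _) (fun p => by linarith [hβ (f p.1 - f p.2)]) h3
    simpa [Real.sqrt_sq] using h5.sqrt
  have hcau : CauchySeq f := by
    rw [cauchySeq_iff_tendsto_dist_atTop_0]
    simpa only [dist_eq_norm] using h2
  obtain ⟨F, hF⟩ := cauchySeq_tendsto_of_complete hcau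
  obtain rfl : S F = x := tendsto_nhds_unique ((S.continuous.tendsto F).comp hF) hux
  refine ⟨ht.mem_domain F, ?_⟩
  simp only [hf, hsub, ht.form_eq]
  have h6 : Tendsto (fun n => f n - F) atTop (𝓝 0) := by
    simpa using hF.sub_const F
  have h7 := h6.inner (𝕜 := ℂ) (h6.add ((K.continuous.tendsto 0).comp h6))
  rwa [inner_zero_left] at h7

end IsPencilForm

end SesqForm

namespace HDot

/-! ### The Fourier transform on `L¹ ∩ L²` -/

/-- Both transforms are locally integrable and have the same integral against every smooth compactly
supported test function: one by duality for tempered distributions, the other by Fubini. -/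
theorem fourier_coeFn {h : L2} (hi : Integrable h volume) :
    (𝓕 h : L2) =ᵐ[volume] 𝓕 (h : ℝ → ℂ) := by
  have hcont : Continuous (𝓕 (h : ℝ → ℂ)) :=
    VectorFourier.fourierIntegral_continuous Real.continuous_fourierChar
      (by exact continuous_inner) hi
  refine ae_eq_of_integral_contDiff_smul_eq
    ((Lp.memLp (𝓕 h : L2)).locallyIntegrable (by norm_num)) hcont.locallyIntegrable ?_
  intro g hg hgc
  have hg₁ : HasCompactSupport (Complex.ofRealCLM ∘ g) := hgc.comp_left rfl
  have hg₂ : ContDiff ℝ (⊤ : ℕ∞) (Complex.ofRealCLM ∘ g) := by fun_prop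
  set φ : 𝓢(ℝ, ℂ) := hg₁.toSchwartzMap hg₂ with hφ
  have hφg : ∀ x, φ x = (g x : ℂ) := fun x => rfl
  calc ∫ x, g x • (𝓕 h : L2) x = ((𝓕 h : L2) : 𝓢'(ℝ, ℂ)) φ := by
        simp [Lp.toTemperedDistribution_apply, hφg]
    _ = (h : 𝓢'(ℝ, ℂ)) (𝓕 φ) := by
        rw [← Lp.fourier_toTemperedDistribution_eq, TemperedDistribution.fourier_apply]
    _ = ∫ x, 𝓕 (φ : ℝ → ℂ) x • h x := by
        simp [Lp.toTemperedDistribution_apply, SchwartzMap.fourier_coe]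
    _ = ∫ x, φ x • 𝓕 (h : ℝ → ℂ) x := by
        have := VectorFourier.integral_fourierIntegral_smul_eq_flip (μ := volume) (ν := volume)
          (L := innerₗ ℝ) (f := (φ : ℝ → ℂ)) Real.continuous_fourierChar
          (by exact continuous_inner) φ.integrable hi
        rwa [flip_innerₗ] at this
    _ = _ := by simp [hφg]

theorem fourierInv_coeFn {h : L2} (hi : Integrable h volume) :
    (𝓕⁻ h : L2) =ᵐ[volume] 𝓕⁻ (h : ℝ → ℂ) := by
  have hL : Continuous fun p : ℝ × ℝ => (-innerₗ ℝ) p.1 p.2 := by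
    have : Continuous fun p : ℝ × ℝ => -inner ℝ p.1 p.2 := continuous_inner.neg
    exact this
  have hcont : Continuous (𝓕⁻ (h : ℝ → ℂ)) :=
    VectorFourier.fourierIntegral_continuous Real.continuous_fourierChar hL hi
  refine ae_eq_of_integral_contDiff_smul_eq
    ((Lp.memLp (𝓕⁻ h : L2)).locallyIntegrable (by norm_num)) hcont.locallyIntegrable ?_
  intro g hg hgc
  have hg₁ : HasCompactSupport (Complex.ofRealCLM ∘ g) := hgc.comp_left rfl
  have hg₂ : ContDiff ℝ (⊤ : ℕ∞) (Complex.ofRealCLM ∘ g) := by fun_prop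
  set φ : 𝓢(ℝ, ℂ) := hg₁.toSchwartzMap hg₂ with hφ
  have hφg : ∀ x, φ x = (g x : ℂ) := fun x => rfl
  calc ∫ x, g x • (𝓕⁻ h : L2) x = ((𝓕⁻ h : L2) : 𝓢'(ℝ, ℂ)) φ := by
        simp [Lp.toTemperedDistribution_apply, hφg]
    _ = (h : 𝓢'(ℝ, ℂ)) (𝓕⁻ φ) := by
        rw [← Lp.fourierInv_toTemperedDistribution_eq, TemperedDistribution.fourierInv_apply]
    _ = ∫ x, 𝓕⁻ (φ : ℝ → ℂ) x • h x := by
        simp [Lp.toTemperedDistribution_apply, SchwartzMap.fourierInv_coe]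
    _ = ∫ x, φ x • 𝓕⁻ (h : ℝ → ℂ) x := by
        have := VectorFourier.integral_fourierIntegral_smul_eq_flip (μ := volume) (ν := volume)
          (L := -innerₗ ℝ) (f := (φ : ℝ → ℂ)) Real.continuous_fourierChar hL φ.integrable hi
        have hflip : (-innerₗ ℝ).flip = -innerₗ ℝ := by
          ext
          simp
        rwa [hflip] at this
    _ = _ := by simp [hφg]

/-- A function in `L²(ℝ)` is weakly differentiable if its Fourier transform says so. -/
theorem isWeakDeriv_of_fourier {u g : L2}
    (h : (𝓕 g : L2) =ᵐ[volume] fun ξ => 2 * Real.pi * Complex.I * ξ * (𝓕 u : L2) ξ) :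
    IsWeakDeriv u g := by
  have hinj : Function.Injective (fun T : 𝓢'(ℝ, ℂ) => 𝓕 T) := fun T T' hT => by
    have := congrArg (fun T : 𝓢'(ℝ, ℂ) => 𝓕⁻ T) hT
    simpa using this
  refine hinj ?_
  change 𝓕 (∂_{(1 : ℝ)} (u : 𝓢'(ℝ, ℂ))) = 𝓕 (g : 𝓢'(ℝ, ℂ))
  rw [TemperedDistribution.fourier_lineDerivOp_eq, Lp.fourier_toTemperedDistribution_eq,
    Lp.fourier_toTemperedDistribution_eq]
  have hl : (fun ξ : ℝ => ((inner ℝ ξ (1 : ℝ) : ℝ) : ℂ)).HasTemperateGrowth := by fun_prop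
  ext φ
  change (2 * Real.pi * Complex.I) • TemperedDistribution.smulLeftCLM ℂ _ _ φ = _
  rw [TemperedDistribution.smulLeftCLM_apply_apply, Lp.toTemperedDistribution_apply,
    Lp.toTemperedDistribution_apply, ← integral_smul]
  refine integral_congr_ae ?_
  filter_upwards [h] with ξ hξ
  rw [hξ, SchwartzMap.smulLeftCLM_apply_apply hl]
  simp only [smul_eq_mul, RCLike.inner_apply, conj_trivial, one_mul]
  ring

/-! ### Multiplication operators in `L²(ℝ)` -/

/-- Multiplication by a bounded function. -/
def mulOp (a : ℝ → ℂ) (ha : MemLp a ⊤ volume) : L2 →L[ℂ] L2 :=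
  (ContinuousLinearMap.mul ℂ ℂ).holderL volume ⊤ 2 2 (ha.toLp a)

theorem mulOp_ae {a : ℝ → ℂ} (ha : MemLp a ⊤ volume) (f : L2) :
    mulOp a ha f =ᵐ[volume] fun ξ => a ξ * f ξ := by
  have h := ContinuousLinearMap.coeFn_holder (r := 2) (ContinuousLinearMap.mul ℂ ℂ) (ha.toLp a) f
  filter_upwards [h, ha.coeFn_toLp] with ξ h1 h2
  change ((ContinuousLinearMap.mul ℂ ℂ).holder 2 (ha.toLp a) f : L2) ξ = _
  rw [h1, h2]
  rfl

theorem inner_mulOp_left {a : ℝ → ℂ} (ha : MemLp a ⊤ volume) (hr : ∀ ξ, conj (a ξ) = a ξ)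
    (f g : L2) : inner ℂ (mulOp a ha f) g = inner ℂ f (mulOp a ha g) := by
  rw [L2.inner_def, L2.inner_def]
  refine integral_congr_ae ?_
  filter_upwards [mulOp_ae ha f, mulOp_ae ha g] with ξ h1 h2
  simp only [h1, h2, RCLike.inner_apply, map_mul, hr]
  ring

theorem eq_mulOp_iff {a : ℝ → ℂ} (ha : MemLp a ⊤ volume) {f g : L2} :
    g = mulOp a ha f ↔ g =ᵐ[volume] fun ξ => a ξ * f ξ := by
  rw [Lp.ext_iff]
  exact ⟨fun h => h.trans (mulOp_ae ha f), fun h => h.trans (mulOp_ae ha f).symm⟩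

theorem memLp_top_ofReal {a : ℝ → ℝ} (ha : Measurable a) {C : ℝ} (hC : ∀ ξ, |a ξ| ≤ C) :
    MemLp (fun ξ => (a ξ : ℂ)) ⊤ volume := by
  refine memLp_top_of_bound (Complex.measurable_ofReal.comp ha).aestronglyMeasurable C
    (ae_of_all _ fun ξ => ?_)
  rw [Complex.norm_real]
  exact hC ξ

theorem ae_ne_zero : ∀ᵐ ξ : ℝ, ξ ≠ 0 := by simp [ae_iff]

/-! ### The symbols -/

theorem absFreq_nonneg (ξ : ℝ) : 0 ≤ absFreq ξ := by unfold absFreq; positivity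

theorem absFreq_pos {ξ : ℝ} (hξ : ξ ≠ 0) : 0 < absFreq ξ := by unfold absFreq; positivity

theorem continuous_absFreq : Continuous absFreq := by unfold absFreq; fun_prop

/-- The symbol `(c²λ² + b²)^{-1/2}`. -/
def symW (b c : ℝ) (ξ : ℝ) : ℝ := (√(c ^ 2 * absFreq ξ ^ 2 + b ^ 2))⁻¹

/-- The symbol `|λ|^{1/2} (c²λ² + b²)^{-1/2} = (c²|λ| + b²|λ|⁻¹)^{-1/2}`. -/
def symR (b c : ℝ) (ξ : ℝ) : ℝ := absFreq ξ ^ (1 / 2 : ℝ) * symW b c ξ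

/-- The symbol `|λ| / (c²λ² + b²) = (c²|λ| + b²|λ|⁻¹)⁻¹`. -/
def symM (b c : ℝ) (ξ : ℝ) : ℝ := absFreq ξ / (c ^ 2 * absFreq ξ ^ 2 + b ^ 2)

section

variable {b c : ℝ}

theorem symbol_pos (hb : 0 < b) (ξ : ℝ) : 0 < c ^ 2 * absFreq ξ ^ 2 + b ^ 2 := by positivity

theorem continuous_symW (hb : 0 < b) : Continuous (symW b c) := by
  have := continuous_absFreq
  refine Continuous.inv₀ (by fun_prop) fun ξ => ?_
  exact (Real.sqrt_pos.2 (symbol_pos hb ξ)).ne'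

theorem continuous_symM (hb : 0 < b) : Continuous (symM b c) := by
  have := continuous_absFreq
  exact continuous_absFreq.div (by fun_prop) fun ξ => (symbol_pos hb ξ).ne'

theorem continuous_symR (hb : 0 < b) : Continuous (symR b c) :=
  (continuous_absFreq.rpow_const fun _ => Or.inr (by norm_num)).mul (continuous_symW hb)

theorem symW_pos (hb : 0 < b) (ξ : ℝ) : 0 < symW b c ξ :=
  inv_pos.2 (Real.sqrt_pos.2 (symbol_pos hb ξ))

theorem symW_sq (hb : 0 < b) (ξ : ℝ) : symW b c ξ ^ 2 = (c ^ 2 * absFreq ξ ^ 2 + b ^ 2)⁻¹ := by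
  rw [symW, inv_pow, Real.sq_sqrt (symbol_pos hb ξ).le]

theorem symW_sq_mul (hb : 0 < b) (ξ : ℝ) :
    (c ^ 2 * absFreq ξ ^ 2 + b ^ 2) * symW b c ξ ^ 2 = 1 := by
  rw [symW_sq hb, mul_inv_cancel₀ (symbol_pos hb ξ).ne']

theorem b_mul_symW_le (hb : 0 < b) (ξ : ℝ) : b * symW b c ξ ≤ 1 := by
  have h1 := symW_sq_mul (c := c) hb ξ
  have h2 := symW_pos (c := c) hb ξ
  refine (abs_le.1 ((sq_le_one_iff_abs_le_one _).1 ?_)).2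
  nlinarith [mul_nonneg (sq_nonneg (c * absFreq ξ)) (sq_nonneg (symW b c ξ))]

theorem c_mul_absFreq_mul_symW_le (hb : 0 < b) (ξ : ℝ) :
    c * (absFreq ξ * symW b c ξ) ≤ 1 := by
  have h1 := symW_sq_mul (c := c) hb ξ
  refine (abs_le.1 ((sq_le_one_iff_abs_le_one _).1 ?_)).2
  nlinarith [mul_nonneg (sq_nonneg b) (sq_nonneg (symW b c ξ))]

theorem symR_nonneg (hb : 0 < b) (ξ : ℝ) : 0 ≤ symR b c ξ :=
  mul_nonneg (Real.rpow_nonneg (absFreq_nonneg ξ) _) (symW_pos hb ξ).le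

theorem symR_pos (hb : 0 < b) {ξ : ℝ} (hξ : ξ ≠ 0) : 0 < symR b c ξ :=
  mul_pos (Real.rpow_pos_of_pos (absFreq_pos hξ) _) (symW_pos hb ξ)

theorem symR_sq (hb : 0 < b) (ξ : ℝ) : symR b c ξ ^ 2 = symM b c ξ := by
  rw [symR, mul_pow, symW_sq hb, symM, ← Real.sqrt_eq_rpow, Real.sq_sqrt (absFreq_nonneg ξ),
    div_eq_mul_inv]

theorem symM_nonneg (hb : 0 < b) (ξ : ℝ) : 0 ≤ symM b c ξ :=
  div_nonneg (absFreq_nonneg ξ) (symbol_pos hb ξ).le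

theorem symM_mul (hb : 0 < b) (ξ : ℝ) :
    symM b c ξ * (c ^ 2 * absFreq ξ ^ 2 + b ^ 2) = absFreq ξ :=
  div_mul_cancel₀ _ (symbol_pos hb ξ).ne'

/-- Arithmetic-geometric mean, in the form `(c|λ| - b)² ≥ 0`. The bottom `2bc` of the essential
spectrum originates here. -/
theorem symM_le (hb : 0 < b) (ξ : ℝ) : 2 * b * c * symM b c ξ ≤ 1 := by
  have h1 := symbol_pos (c := c) hb ξ
  rw [symM, ← mul_div_assoc, div_le_one h1]
  nlinarith [sq_nonneg (c * absFreq ξ - b)]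

theorem memLp_symW (hb : 0 < b) : MemLp (fun ξ => (symW b c ξ : ℂ)) ⊤ volume := by
  refine memLp_top_ofReal (continuous_symW hb).measurable (C := 1 / b) fun ξ => ?_
  rw [abs_of_pos (symW_pos hb ξ), le_div_iff₀ hb, mul_comm]
  exact b_mul_symW_le hb ξ

theorem memLp_symM (hb : 0 < b) (hc : 0 < c) : MemLp (fun ξ => (symM b c ξ : ℂ)) ⊤ volume := by
  refine memLp_top_ofReal (continuous_symM hb).measurable (C := 1 / (2 * b * c)) fun ξ => ?_
  rw [abs_of_nonneg (symM_nonneg hb ξ), le_div_iff₀ (by positivity), mul_comm]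
  exact symM_le hb ξ

theorem memLp_symR (hb : 0 < b) (hc : 0 < c) : MemLp (fun ξ => (symR b c ξ : ℂ)) ⊤ volume := by
  refine memLp_top_ofReal (continuous_symR hb).measurable (C := √(1 / (2 * b * c))) fun ξ => ?_
  rw [abs_of_nonneg (symR_nonneg hb ξ)]
  refine Real.le_sqrt_of_sq_le ?_
  rw [symR_sq hb, le_div_iff₀ (by positivity), mul_comm]
  exact symM_le hb ξ

/-- The symbol `iλ (c²λ² + b²)^{-1/2}`. -/
def symD (b c : ℝ) (ξ : ℝ) : ℂ := 2 * Real.pi * Complex.I * ξ * symW b c ξ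

theorem norm_symD (hb : 0 < b) (ξ : ℝ) : ‖symD b c ξ‖ = absFreq ξ * symW b c ξ := by
  rw [symD, norm_mul, Complex.norm_real, Real.norm_of_nonneg (symW_pos hb ξ).le]
  simp [absFreq, abs_of_pos Real.pi_pos]

theorem continuous_symD (hb : 0 < b) : Continuous (symD b c) := by
  have := continuous_symW (c := c) hb
  unfold symD
  fun_prop

theorem memLp_symD (hb : 0 < b) (hc : 0 < c) : MemLp (symD b c) ⊤ volume := by
  refine memLp_top_of_bound (continuous_symD hb).aestronglyMeasurable (1 / c)
    (ae_of_all _ fun ξ => ?_)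
  rw [norm_symD hb, le_div_iff₀ hc, mul_comm]
  exact c_mul_absFreq_mul_symW_le hb ξ

/-- The square of the symbol decays like `λ⁻²`. This square integrability makes point evaluation a
bounded functional on `H¹`. -/
theorem memLp_two_symW (hb : 0 < b) (hc : 0 < c) :
    MemLp (fun ξ => (symW b c ξ : ℂ)) 2 volume := by
  have hm : Measurable fun ξ => (symW b c ξ : ℂ) :=
    Complex.measurable_ofReal.comp (continuous_symW hb).measurable
  rw [memLp_two_iff_integrable_sq_norm hm.aestronglyMeasurable]
  -- The constant comes from `min(b², c²)(1 + ξ²) ≤ c²(2πξ)² + b²`, where `(2π)² ≥ 1` is used.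
  have h1 : Integrable (fun ξ : ℝ => (min (b ^ 2) (c ^ 2))⁻¹ * (1 + ξ ^ 2)⁻¹) volume :=
    integrable_inv_one_add_sq.const_mul _
  refine h1.mono' (hm.norm.pow_const 2).aestronglyMeasurable (ae_of_all _ fun ξ => ?_)
  rw [Complex.norm_real, Real.norm_of_nonneg (symW_pos hb ξ).le, symW_sq hb, norm_inv,
    Real.norm_of_nonneg (symbol_pos hb ξ).le, ← mul_inv]
  have hmin : 0 < min (b ^ 2) (c ^ 2) := by positivity
  gcongr
  have h2 : ξ ^ 2 ≤ absFreq ξ ^ 2 := by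
    rw [absFreq, mul_pow, sq_abs]
    have : 1 ≤ (2 * Real.pi) ^ 2 := by nlinarith [Real.pi_gt_three]
    nlinarith [sq_nonneg ξ]
  nlinarith [min_le_left (b ^ 2) (c ^ 2), min_le_right (b ^ 2) (c ^ 2), sq_nonneg ξ,
    mul_le_mul_of_nonneg_right (min_le_right (b ^ 2) (c ^ 2)) (sq_nonneg ξ),
    mul_le_mul_of_nonneg_left h2 (sq_nonneg c)]

end

end HDot

namespace HDot

open ContinuousLinearMap

variable {b c : ℝ}

/-! ### `H¹(ℝ)` as the image of `L²(ℝ)` -/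

theorem isWeakDeriv_fourierInv (hb : 0 < b) (hc : 0 < c) (f : L2) :
    IsWeakDeriv (𝓕⁻ (mulOp _ (memLp_symW hb (c := c)) f) : L2)
      (𝓕⁻ (mulOp _ (memLp_symD hb hc) f) : L2) := by
  refine isWeakDeriv_of_fourier ?_
  rw [FourierTransform.fourier_fourierInv_eq, FourierTransform.fourier_fourierInv_eq]
  filter_upwards [mulOp_ae (memLp_symW hb (c := c)) f, mulOp_ae (memLp_symD hb hc) f]
    with ξ h1 h2
  rw [h1, h2, symD]
  ring

/-- The map `f ↦ (c²|D|² + b²)^{-1/2} 𝓕⁻¹ f` from `L²(ℝ)` onto `H¹(ℝ)`. -/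
def toSobolevOne (hb : 0 < b) (hc : 0 < c) : L2 →ₗ[ℂ] sobolevOne where
  toFun f := ⟨𝓕⁻ (mulOp _ (memLp_symW hb (c := c)) f), _, isWeakDeriv_fourierInv hb hc f⟩
  map_add' f g := Subtype.ext (by
    simp only [map_add, FourierTransform.fourierInv_add, Submodule.coe_add])
  map_smul' a f := Subtype.ext (by
    simp only [map_smul, FourierTransform.fourierInv_smul, Submodule.coe_smul, RingHom.id_apply])

theorem coe_toSobolevOne (hb : 0 < b) (hc : 0 < c) (f : L2) :
    (toSobolevOne hb hc f : L2) = 𝓕⁻ (mulOp _ (memLp_symW hb (c := c)) f) := rfl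

theorem weakDeriv_toSobolevOne (hb : 0 < b) (hc : 0 < c) (f : L2) :
    weakDeriv (toSobolevOne hb hc f) = 𝓕⁻ (mulOp _ (memLp_symD hb hc) f) :=
  (weakDeriv_spec _).unique (isWeakDeriv_fourierInv hb hc f)

/-- The preimage of `u` with `g = u'` is `√(c²λ² + b²) 𝓕 u`, which is in `L²` because its modulus is
at most `c|𝓕 g| + b|𝓕 u|`. -/
theorem toSobolevOne_surjective (hb : 0 < b) (hc : 0 < c) :
    Function.Surjective (toSobolevOne hb hc) := by
  rintro ⟨u, g, hg⟩
  have hmeas : AEStronglyMeasurable (fun ξ => (((symW b c ξ)⁻¹ : ℝ) : ℂ) * (𝓕 u : L2) ξ)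
      volume :=
    (Complex.measurable_ofReal.comp (continuous_symW hb).measurable.inv).aestronglyMeasurable.mul
      (Lp.aestronglyMeasurable _)
  have hmem : MemLp (fun ξ => (((symW b c ξ)⁻¹ : ℝ) : ℂ) * (𝓕 u : L2) ξ) 2 volume := by
    have hbd : MemLp (fun ξ => c * ‖(𝓕 g : L2) ξ‖ + b * ‖(𝓕 u : L2) ξ‖) 2 volume :=
      ((Lp.memLp (𝓕 g : L2)).norm.const_mul c).add ((Lp.memLp (𝓕 u : L2)).norm.const_mul b)
    refine hbd.mono hmeas ?_
    filter_upwards [norm_fourier_of_isWeakDeriv hg] with ξ hξ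
    have h0 := absFreq_nonneg ξ
    rw [Real.norm_of_nonneg (by positivity), hξ, norm_mul, Complex.norm_real,
      Real.norm_of_nonneg (inv_nonneg.2 (symW_pos hb ξ).le), symW, inv_inv, ← mul_assoc, ← add_mul]
    refine mul_le_mul_of_nonneg_right ?_ (norm_nonneg _)
    rw [Real.sqrt_le_left (by positivity)]
    nlinarith [mul_nonneg (mul_nonneg hc.le h0) hb.le]
  refine ⟨hmem.toLp _, Subtype.ext ?_⟩
  have h1 : (𝓕 u : L2) = mulOp _ (memLp_symW hb (c := c)) (hmem.toLp _) := by
    rw [eq_mulOp_iff]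
    filter_upwards [hmem.coeFn_toLp] with ξ h
    rw [h, ← mul_assoc, ← Complex.ofReal_mul, mul_inv_cancel₀ (symW_pos hb ξ).ne',
      Complex.ofReal_one, one_mul]
  rw [coe_toSobolevOne, ← h1, FourierTransform.fourierInv_fourier_eq]

theorem j_embOne_toSobolevOne (hb : 0 < b) (hc : 0 < c) (f : L2) :
    j (embOne (toSobolevOne hb hc f)) = mulOp _ (memLp_symR hb hc) f := by
  rw [eq_mulOp_iff]
  set v : HHalf := Submodule.inclusion sobolevOne_le_sobolevHalf (toSobolevOne hb hc f) with hv
  have h1 : j (embOne (toSobolevOne hb hc f)) = j₀ v := j_coe v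
  have h2 : v.toL2 = 𝓕⁻ (mulOp _ (memLp_symW hb (c := c)) f) := rfl
  have h3 : j₀ v =ᵐ[volume] halfFourier v.toL2 := v.memLp.coeFn_toLp
  rw [h1]
  filter_upwards [h3, mulOp_ae (memLp_symW hb (c := c)) f] with ξ e1 e2
  rw [e1, halfFourier, h2, FourierTransform.fourier_fourierInv_eq, e2, symR]
  push_cast
  ring

/-- The isomorphism `L²(ℝ) → H¹(ℝ)`, as an operator into `Ḣ^{1/2}(ℝ)`. -/
def opS (hb : 0 < b) (hc : 0 < c) : L2 →L[ℂ] HDotHalf :=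
  (embOne ∘ₗ toSobolevOne hb hc).mkContinuous ‖mulOp _ (memLp_symR hb hc)‖ fun f => by
    rw [LinearMap.comp_apply, ← norm_j, j_embOne_toSobolevOne]
    exact le_opNorm _ _

theorem j_opS (hb : 0 < b) (hc : 0 < c) (f : L2) :
    j (opS hb hc f) = mulOp _ (memLp_symR hb hc) f := j_embOne_toSobolevOne hb hc f

theorem inner_j (x y : HDotHalf) : inner ℂ (j x) (j y) = inner ℂ x y :=
  (LinearIsometry.mk j.toLinearMap norm_j).inner_map_map x y

theorem mulOp_injective {a : ℝ → ℂ} (ha : MemLp a ⊤ volume) (h0 : ∀ᵐ ξ : ℝ, a ξ ≠ 0) :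
    Function.Injective (mulOp a ha) := by
  rw [injective_iff_map_eq_zero]
  intro f hf
  rw [Lp.eq_zero_iff_ae_eq_zero] at hf ⊢
  filter_upwards [hf, mulOp_ae ha f, h0] with ξ h1 h2 h3
  rw [h1] at h2
  exact (mul_eq_zero.1 h2.symm).resolve_left h3

theorem mulOp_symR_injective (hb : 0 < b) (hc : 0 < c) :
    Function.Injective (mulOp _ (memLp_symR hb hc)) := by
  refine mulOp_injective _ ?_
  filter_upwards [ae_ne_zero] with ξ hξ
  exact Complex.ofReal_ne_zero.2 (symR_pos hb hξ).ne'

theorem opS_injective (hb : 0 < b) (hc : 0 < c) : Function.Injective (opS hb hc) := by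
  intro f g hfg
  refine mulOp_symR_injective hb hc ?_
  rw [← j_opS hb hc, ← j_opS hb hc, hfg]

theorem adjoint_opS (hb : 0 < b) (hc : 0 < c) (w : HDotHalf) :
    adjoint (opS hb hc) w = mulOp _ (memLp_symR hb hc) (j w) := by
  refine ext_inner_left ℂ fun f => ?_
  rw [adjoint_inner_right, ← inner_j, j_opS, inner_mulOp_left]
  exact fun ξ => Complex.conj_ofReal _

theorem adjoint_opS_injective (hb : 0 < b) (hc : 0 < c) :
    Function.Injective (adjoint (opS hb hc)) := by
  intro w w' h
  rw [adjoint_opS, adjoint_opS] at h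
  exact j_injective (mulOp_symR_injective hb hc h)

theorem denseRange_opS (hb : 0 < b) (hc : 0 < c) : DenseRange (opS hb hc) := by
  refine denseRange_of_forall_inner fun w hw => adjoint_opS_injective hb hc ?_
  rw [map_zero, ← inner_self_eq_zero (𝕜 := ℂ), adjoint_inner_right, hw]

theorem adjoint_opS_opS (hb : 0 < b) (hc : 0 < c) (f : L2) :
    adjoint (opS hb hc) (opS hb hc f) = mulOp _ (memLp_symM hb hc) f := by
  rw [adjoint_opS, j_opS, eq_mulOp_iff]
  filter_upwards [mulOp_ae (memLp_symR hb hc) f,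
    mulOp_ae (memLp_symR hb hc) (mulOp _ (memLp_symR hb hc) f)] with ξ h1 h2
  rw [h2, h1, ← symR_sq hb]
  push_cast
  ring

/-- An isometry on a complete space has closed range. The range is dense because it contains the
image of multiplication by the almost everywhere positive symbol `symR`; the values `b = c = 1` are
an arbitrary choice. -/
theorem j_surjective : Function.Surjective j := by
  have hrange : IsClosed (Set.range j) :=
    (AddMonoidHomClass.isometry_of_norm j norm_j).isClosedEmbedding.isClosed_range
  have hdense : DenseRange j := by
    refine denseRange_of_forall_inner fun g hg => ?_
    refine mulOp_symR_injective one_pos one_pos ?_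
    refine ext_inner_left ℂ fun f => ?_
    rw [map_zero, inner_zero_right, ← inner_mulOp_left _ fun ξ => Complex.conj_ofReal _,
      ← j_opS one_pos one_pos]
    exact hg _
  exact Set.range_eq_univ.1 (by rw [← hrange.closure_eq]; exact hdense.closure_range)

/-! ### The unperturbed operator -/

theorem exists_absD_graph {a : ℝ → ℝ} (ha : Measurable a) {C : ℝ} (hC : ∀ ξ, |a ξ| ≤ C) (g : L2) :
    ∃ w, j w =ᵐ[volume] fun ξ => (a ξ : ℂ) * g ξ := by
  obtain ⟨w, hw⟩ := j_surjective (mulOp _ (memLp_top_ofReal ha hC) g)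
  refine ⟨w, ?_⟩
  rw [hw]
  exact mulOp_ae _ g

/-- Inverting the symbol replaces the two domain conditions by one bounded multiplier. They are
recovered from it because `|λ| m ≤ 1/c²` and `|λ|⁻¹ m = (c²λ² + b²)⁻¹ ≤ 1/b²`, so `|D| u` and `|D|⁻¹
u` are bounded multipliers applied to `w`. -/
theorem mem_graph_opL₀ {u w : HDotHalf} (hb : 0 < b) (hc : 0 < c) :
    (u, w) ∈ (opL₀ b c).graph ↔ j u = mulOp _ (memLp_symM hb hc) (j w) := by
  constructor
  · intro h
    obtain ⟨y, rfl, hy2⟩ := (LinearPMap.mem_graph_iff _).1 h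
    simp only at hy2
    have h1 := (mem_graph_absD 1 _ _).1 ((absD 1).mem_graph ⟨y, y.2.1⟩)
    have h2 := (mem_graph_absD (-1) _ _).1 ((absD (-1)).mem_graph ⟨y, y.2.2⟩)
    have h3 : w = (c : ℂ) ^ 2 • absD 1 ⟨y, y.2.1⟩ + (b : ℂ) ^ 2 • absD (-1) ⟨y, y.2.2⟩ :=
      hy2.symm
    have h4 := congrArg j h3
    rw [map_add, map_smul, map_smul] at h4
    rw [eq_mulOp_iff]
    filter_upwards [h1, h2, ae_ne_zero, Lp.ext_iff.1 h4,
      Lp.coeFn_add ((c : ℂ) ^ 2 • j (absD 1 ⟨y, y.2.1⟩)) ((b : ℂ) ^ 2 • j (absD (-1) ⟨y, y.2.2⟩)),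
      Lp.coeFn_smul ((c : ℂ) ^ 2) (j (absD 1 ⟨y, y.2.1⟩)),
      Lp.coeFn_smul ((b : ℂ) ^ 2) (j (absD (-1) ⟨y, y.2.2⟩))] with ξ e1 e2 e0 e3 e4 e5 e6
    rw [e3, e4, Pi.add_apply, e5, e6, Pi.smul_apply, Pi.smul_apply, e1, e2, Real.rpow_one,
      Real.rpow_neg_one, symM, smul_eq_mul, smul_eq_mul]
    have hA : (absFreq ξ : ℂ) ≠ 0 := Complex.ofReal_ne_zero.2 (absFreq_pos e0).ne'
    have hB : (absFreq ξ : ℂ) ^ 2 * (c : ℂ) ^ 2 + (b : ℂ) ^ 2 ≠ 0 := by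
      rw [mul_comm]
      exact_mod_cast (symbol_pos (c := c) hb ξ).ne'
    push_cast
    field_simp
  · intro h
    rw [eq_mulOp_iff] at h
    have hm1 : Measurable fun ξ => absFreq ξ * symM b c ξ :=
      continuous_absFreq.measurable.mul (continuous_symM hb).measurable
    have hm2 : Measurable fun ξ => (c ^ 2 * absFreq ξ ^ 2 + b ^ 2)⁻¹ :=
      ((continuous_absFreq.measurable.pow_const 2).const_mul _ |>.add_const _).inv
    obtain ⟨w₁, hw₁⟩ := exists_absD_graph hm1 (C := 1 / c ^ 2) (fun ξ => by
      have h0 := symbol_pos (c := c) hb ξ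
      have h1 := absFreq_nonneg ξ
      rw [abs_of_nonneg (mul_nonneg h1 (symM_nonneg hb ξ)), symM,
        le_div_iff₀ (by positivity), ← mul_div_assoc, div_mul_eq_mul_div, div_le_one h0]
      nlinarith) (j w)
    obtain ⟨w₂, hw₂⟩ := exists_absD_graph hm2 (C := 1 / b ^ 2) (fun ξ => by
      have h0 := symbol_pos (c := c) hb ξ
      rw [abs_of_nonneg (inv_nonneg.2 h0.le), ← one_div]
      gcongr
      nlinarith [mul_nonneg (sq_nonneg c) (sq_nonneg (absFreq ξ))]) (j w)
    have h1 : (u, w₁) ∈ (absD 1).graph := by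
      rw [mem_graph_absD]
      filter_upwards [h, hw₁] with ξ e1 e2
      rw [e1, e2, Real.rpow_one]
      push_cast
      ring
    have h2 : (u, w₂) ∈ (absD (-1)).graph := by
      rw [mem_graph_absD]
      filter_upwards [h, hw₂, ae_ne_zero] with ξ e1 e2 e0
      rw [e1, e2, Real.rpow_neg_one, symM]
      have hA : (absFreq ξ : ℂ) ≠ 0 := Complex.ofReal_ne_zero.2 (absFreq_pos e0).ne'
      push_cast
      field_simp
    obtain ⟨y₁, rfl, hy₁⟩ := (LinearPMap.mem_graph_iff _).1 h1
    obtain ⟨y₂, hy, hy₂⟩ := (LinearPMap.mem_graph_iff _).1 h2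
    simp only at hy hy₁ hy₂
    refine (LinearPMap.mem_graph_iff _).2 ⟨⟨y₁, y₁.2, hy ▸ y₂.2⟩, rfl, ?_⟩
    change (c : ℂ) ^ 2 • absD 1 ⟨y₁, y₁.2⟩ + (b : ℂ) ^ 2 • absD (-1) ⟨y₁, hy ▸ y₂.2⟩ = w
    have h3 : (⟨y₁, hy ▸ y₂.2⟩ : (absD (-1)).domain) = y₂ := Subtype.ext hy.symm
    rw [h3, Subtype.coe_eta, hy₁, hy₂]
    apply j_injective
    rw [map_add, map_smul, map_smul, Lp.ext_iff]
    filter_upwards [hw₁, hw₂, Lp.coeFn_add ((c : ℂ) ^ 2 • j w₁) ((b : ℂ) ^ 2 • j w₂),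
      Lp.coeFn_smul ((c : ℂ) ^ 2) (j w₁), Lp.coeFn_smul ((b : ℂ) ^ 2) (j w₂)]
      with ξ e1 e2 e3 e4 e5
    rw [e3, Pi.add_apply, e4, e5, Pi.smul_apply, Pi.smul_apply, e1, e2, smul_eq_mul, smul_eq_mul,
      symM]
    have hB : (c : ℂ) ^ 2 * (absFreq ξ : ℂ) ^ 2 + (b : ℂ) ^ 2 ≠ 0 := by
      exact_mod_cast (symbol_pos (c := c) hb ξ).ne'
    push_cast
    field_simp

/-- Links the operator defined by symbols to the form: since `m` is the square of `symR`, the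
condition `j u = m j w` says that `u = S S† w`. -/
theorem opL₀_eq_assocOp (hb : 0 < b) (hc : 0 < c) : opL₀ b c = assocOp (opS hb hc) 0 := by
  refine LinearPMap.eq_of_eq_graph ?_
  ext ⟨u, w⟩
  rw [mem_graph_opL₀ hb hc, mem_graph_assocOp (opS_injective hb hc) (denseRange_opS hb hc)]
  have hcomp : ∀ g, mulOp _ (memLp_symM hb hc) g =
      mulOp _ (memLp_symR hb hc) (mulOp _ (memLp_symR hb hc) g) := fun g => by
    rw [← j_opS hb hc g, ← adjoint_opS hb hc, adjoint_opS_opS]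
  constructor
  · intro h
    refine ⟨adjoint (opS hb hc) w, j_injective ?_, by rw [zero_apply, add_zero]⟩
    rw [j_opS, adjoint_opS, h, hcomp]
  · rintro ⟨f, rfl, hf⟩
    rw [zero_apply, add_zero] at hf
    rw [j_opS, hf, adjoint_opS, hcomp]

/-! ### The spectrum of the unperturbed operator -/

theorem pencil_opS_ae (hb : 0 < b) (hc : 0 < c) (z : ℂ) (f : L2) :
    pencil (opS hb hc) 0 z f =ᵐ[volume] fun ξ => (1 - z * symM b c ξ) * f ξ := by
  have h : pencil (opS hb hc) 0 z f = f - z • mulOp _ (memLp_symM hb hc) f := by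
    rw [pencil_apply, zero_apply, add_zero, adjoint_opS_opS]
  rw [h]
  filter_upwards [Lp.coeFn_sub f (z • mulOp _ (memLp_symM hb hc) f),
    Lp.coeFn_smul z (mulOp _ (memLp_symM hb hc) f), mulOp_ae (memLp_symM hb hc) f]
    with ξ e1 e2 e3
  rw [e1, Pi.sub_apply, e2, Pi.smul_apply, e3, smul_eq_mul]
  ring

/-- The range of the symbol of `𝓛₀`, as a subset of the complex plane. -/
def specSet (b c : ℝ) : Set ℂ := (fun r : ℝ => (r : ℂ)) '' Set.Ici (2 * b * c)

theorem isClosed_specSet : IsClosed (specSet b c) :=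
  Complex.isometry_ofReal.isClosedEmbedding.isClosedMap _ isClosed_Ici

theorem accPt_specSet {z : ℂ} (hz : z ∈ specSet b c) : AccPt z (𝓟 (specSet b c)) := by
  obtain ⟨r, hr, rfl⟩ := hz
  rw [accPt_iff_frequently]
  have h1 : Tendsto (fun n : ℕ => ((r + 1 / ((n : ℝ) + 1) : ℝ) : ℂ)) atTop (𝓝 (r : ℂ)) := by
    have := tendsto_one_div_add_atTop_nhds_zero_nat (𝕜 := ℝ)
    have h2 := (tendsto_const_nhds (x := r)).add this
    rw [add_zero] at h2
    exact (Complex.continuous_ofReal.tendsto r).comp h2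
  refine h1.frequently (Eventually.frequently (Eventually.of_forall fun n => ⟨?_, ?_⟩))
  · intro h
    have h2 : r + 1 / ((n : ℝ) + 1) = r := Complex.ofReal_injective h
    have h3 : 0 < 1 / ((n : ℝ) + 1) := by positivity
    linarith
  · refine ⟨_, ?_, rfl⟩
    have h3 : 0 < 1 / ((n : ℝ) + 1) := by positivity
    exact le_trans (Set.mem_Ici.1 hr) (by linarith)

/-- The symbol `1 - z m` vanishes at finitely many frequencies only, so the unperturbed operator has
no eigenvalues. -/
theorem injective_pencil_opS (hb : 0 < b) (hc : 0 < c) (z : ℂ) :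
    Function.Injective (pencil (opS hb hc) 0 z) := by
  rw [injective_iff_map_eq_zero]
  intro f hf
  rw [Lp.eq_zero_iff_ae_eq_zero] at hf ⊢
  have hfin : Set.Finite {ξ : ℝ | 1 - z * symM b c ξ = 0} := by
    -- The real part of `1 - z m`, cleared of its denominator, as a polynomial in `t = |λ|`. It is
    -- nonzero because its value at `0` is `b²`.
    set p : Polynomial ℝ := Polynomial.C (c ^ 2) * Polynomial.X ^ 2 -
      Polynomial.C z.re * Polynomial.X + Polynomial.C (b ^ 2) with hp
    have hp0 : p ≠ 0 := fun h => by
      have := congrArg (Polynomial.eval 0) h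
      simp [hp, hb.ne'] at this
    have hroots : Set.Finite {t : ℝ | p.IsRoot t} := Polynomial.finite_setOfPred_isRoot hp0
    have hsub : {ξ : ℝ | 1 - z * symM b c ξ = 0} ⊆ absFreq ⁻¹' {t : ℝ | p.IsRoot t} := by
      intro ξ hξ
      have h1 := congrArg Complex.re hξ
      have h2 := symM_mul (c := c) hb ξ
      simp only [Complex.sub_re, Complex.one_re, Complex.mul_re, Complex.ofReal_re,
        Complex.ofReal_im, mul_zero, sub_zero, Complex.zero_re] at h1
      simp only [Set.mem_preimage, Set.mem_ofPred_eq, Polynomial.IsRoot, hp, Polynomial.eval_add,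
        Polynomial.eval_sub, Polynomial.eval_mul, Polynomial.eval_C, Polynomial.eval_pow,
        Polynomial.eval_X]
      linear_combination (c ^ 2 * absFreq ξ ^ 2 + b ^ 2) * h1 + z.re * h2
    refine Set.Finite.subset ?_ hsub
    refine hroots.preimage' fun t _ => ?_
    have hsub' : absFreq ⁻¹' {t} ⊆ {t / (2 * Real.pi), -(t / (2 * Real.pi))} := by
      intro ξ hξ
      have h1 : 2 * Real.pi * |ξ| = t := hξ
      have h2 : |ξ| = t / (2 * Real.pi) := by
        rw [← h1]
        field_simp
      rcases eq_or_eq_neg_of_abs_eq h2 with h | h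
      · exact Or.inl h
      · exact Or.inr h
    exact (Set.toFinite _).subset hsub'
  have hae : ∀ᵐ ξ : ℝ, ¬ (1 - z * symM b c ξ = 0) := hfin.measure_zero volume |> fun h => by
    rw [ae_iff]
    simpa using h
  filter_upwards [hf, pencil_opS_ae hb hc z f, hae] with ξ h1 h2 h3
  rw [h1] at h2
  exact (mul_eq_zero.1 h2.symm).resolve_left h3

/-- The values of `m` lie in the compact interval `[0, 1/(2bc)]`. There `1 - z t` has no zero, since
a zero would give `z = 1/t ≥ 2bc`. -/
theorem exists_le_norm_symbol (hb : 0 < b) (hc : 0 < c) {z : ℂ} (hz : z ∉ specSet b c) :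
    ∃ δ : ℝ, 0 < δ ∧ ∀ ξ : ℝ, δ ≤ ‖1 - z * symM b c ξ‖ := by
  have hpos : 0 < 1 / (2 * b * c) := by positivity
  have hcomp : IsCompact (Set.Icc 0 (1 / (2 * b * c))) := isCompact_Icc
  obtain ⟨t, ht, hmin⟩ := hcomp.exists_isMinOn (f := fun t : ℝ => ‖1 - z * (t : ℂ)‖)
    ⟨0, le_rfl, hpos.le⟩ (by fun_prop)
  refine ⟨‖1 - z * (t : ℂ)‖, ?_, fun ξ => ?_⟩
  · rw [norm_pos_iff, sub_ne_zero]
    intro h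
    have ht0 : t ≠ 0 := by
      rintro rfl
      simp at h
    have htpos : 0 < t := lt_of_le_of_ne ht.1 ht0.symm
    refine hz ⟨t⁻¹, ?_, ?_⟩
    · have := ht.2
      rw [Set.mem_Ici, ← one_div, le_div_iff₀ htpos]
      rw [le_div_iff₀ (by positivity)] at this
      linarith
    · have : (t : ℂ) ≠ 0 := Complex.ofReal_ne_zero.2 ht0
      change ((t⁻¹ : ℝ) : ℂ) = z
      rw [Complex.ofReal_inv]
      field_simp
      rw [h, mul_comm]
  · refine hmin ⟨symM_nonneg hb ξ, ?_⟩
    rw [le_div_iff₀ (by positivity), mul_comm]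
    exact symM_le hb ξ

theorem isUnit_pencil_opS (hb : 0 < b) (hc : 0 < c) {z : ℂ} (hz : z ∉ specSet b c) :
    IsUnit (pencil (opS hb hc) 0 z) := by
  obtain ⟨δ, hδ, h⟩ := exists_le_norm_symbol hb hc hz
  rw [ContinuousLinearMap.isUnit_iff_bijective]
  refine ⟨injective_pencil_opS hb hc z, fun g => ?_⟩
  have hmeas : Measurable fun ξ : ℝ => (1 - z * symM b c ξ)⁻¹ := by
    have := (continuous_symM (c := c) hb).measurable
    fun_prop
  have hinv : MemLp (fun ξ : ℝ => (1 - z * symM b c ξ)⁻¹) ⊤ volume := by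
    refine memLp_top_of_bound hmeas.aestronglyMeasurable δ⁻¹ (ae_of_all _ fun ξ => ?_)
    rw [norm_inv]
    exact inv_anti₀ hδ (h ξ)
  refine ⟨mulOp _ hinv g, ?_⟩
  rw [Lp.ext_iff]
  filter_upwards [pencil_opS_ae hb hc z (mulOp _ hinv g), mulOp_ae hinv g] with ξ h1 h2
  have hne : 1 - z * symM b c ξ ≠ 0 := norm_pos_iff.1 (hδ.trans_le (h ξ))
  rw [h1, h2, mul_inv_cancel_left₀ hne]

theorem exists_symM_eq (hb : 0 < b) (hc : 0 < c) {r : ℝ} (hr : 2 * b * c ≤ r) :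
    ∃ ξ, r * symM b c ξ = 1 := by
  have hbc : 0 < b * c := mul_pos hb hc
  have hr0 : 0 < r := by nlinarith
  have hD : 0 ≤ r ^ 2 - 4 * b ^ 2 * c ^ 2 := by nlinarith
  -- The larger root of `c²t² - r t + b² = 0`, real because `r ≥ 2bc`; the frequency is then
  -- `t/(2π)`.
  set t := (r + √(r ^ 2 - 4 * b ^ 2 * c ^ 2)) / (2 * c ^ 2) with ht
  have ht0 : 0 < t := by positivity
  refine ⟨t / (2 * Real.pi), ?_⟩
  have hA : absFreq (t / (2 * Real.pi)) = t := by
    rw [absFreq, abs_of_pos (by positivity)]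
    field_simp
  rw [symM, hA, ← mul_div_assoc, div_eq_one_iff_eq (by positivity)]
  have h1 : 2 * c ^ 2 * t - r = √(r ^ 2 - 4 * b ^ 2 * c ^ 2) := by
    rw [ht]
    field_simp
    ring
  have h2 := Real.sq_sqrt hD
  rw [← h1] at h2
  have h3 : c ^ 2 * (r * t - (c ^ 2 * t ^ 2 + b ^ 2)) = 0 := by linear_combination (-1 / 4) * h2
  have h4 := (mul_eq_zero.1 h3).resolve_left (by positivity)
  linarith

/-- Approximate eigenvectors: the indicator of a small open set around a zero of the symbol is
almost annihilated, which contradicts a bounded inverse. -/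
theorem not_isUnit_pencil_opS (hb : 0 < b) (hc : 0 < c) {z : ℂ} (hz : z ∈ specSet b c) :
    ¬ IsUnit (pencil (opS hb hc) 0 z) := by
  obtain ⟨r, hr, rfl⟩ := hz
  intro hu
  obtain ⟨ξ₀, hξ₀⟩ := exists_symM_eq hb hc (Set.mem_Ici.1 hr)
  set Q := Ring.inverse (pencil (opS hb hc) 0 (r : ℂ)) with hQ
  set ε : ℝ := (‖Q‖ + 1)⁻¹ / 2 with hε
  have hε0 : 0 < ε := by positivity
  have hQε : ‖Q‖ * ε < 1 := by
    have : ‖Q‖ * (‖Q‖ + 1)⁻¹ ≤ 1 := by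
      rw [← div_eq_mul_inv, div_le_one (by positivity)]
      linarith
    have h2 : ‖Q‖ * ε = ‖Q‖ * (‖Q‖ + 1)⁻¹ / 2 := by rw [hε]; ring
    rw [h2]
    linarith
  -- The ball only keeps the measure finite; positive measure comes from openness.
  set s : Set ℝ := {ξ | |1 - r * symM b c ξ| < ε} ∩ Metric.ball ξ₀ 1 with hs
  have hopen : IsOpen s := by
    have := continuous_symM (c := c) hb
    exact (isOpen_lt (by fun_prop) continuous_const).inter Metric.isOpen_ball
  have hξs : ξ₀ ∈ s := ⟨by simpa [hξ₀] using hε0, by simp⟩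
  have hpos : 0 < volume s := hopen.measure_pos volume ⟨ξ₀, hξs⟩
  have hfin : volume s ≠ ⊤ :=
    ((measure_mono Set.inter_subset_right).trans_lt measure_ball_lt_top).ne
  set f : L2 := indicatorConstLp 2 hopen.measurableSet hfin (1 : ℂ) with hf
  have hf0 : f ≠ 0 := by
    intro h
    rw [Lp.eq_zero_iff_ae_eq_zero] at h
    have h1 : ∀ᵐ ξ : ℝ, ξ ∉ s := by
      filter_upwards [h, indicatorConstLp_coeFn (p := 2) (hs := hopen.measurableSet) (hμs := hfin)
        (c := (1 : ℂ))] with ξ e1 e2 hξ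
      rw [← hf, e1, Set.indicator_of_mem hξ] at e2
      exact zero_ne_one e2
    rw [ae_iff] at h1
    simp only [not_not] at h1
    exact hpos.ne' h1
  have hle : ‖pencil (opS hb hc) 0 (r : ℂ) f‖ ≤ ε * ‖f‖ := by
    refine Lp.norm_le_mul_norm_of_ae_le_mul ?_
    filter_upwards [pencil_opS_ae hb hc (r : ℂ) f, indicatorConstLp_coeFn (p := 2)
      (hs := hopen.measurableSet) (hμs := hfin) (c := (1 : ℂ))] with ξ e1 e2
    rw [e1, norm_mul]
    by_cases hξ : ξ ∈ s
    · refine mul_le_mul_of_nonneg_right ?_ (norm_nonneg _)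
      have h1 : (1 : ℂ) - r * symM b c ξ = ((1 - r * symM b c ξ : ℝ) : ℂ) := by push_cast; ring
      rw [h1, Complex.norm_real]
      exact hξ.1.le
    · rw [hf, e2, Set.indicator_of_notMem hξ]
      simp
  have h1 : ‖f‖ ≤ ‖Q‖ * (ε * ‖f‖) := by
    have h2 := Q.le_opNorm (pencil (opS hb hc) 0 (r : ℂ) f)
    rw [hQ, inverse_apply_self hu, ← hQ] at h2
    exact h2.trans (mul_le_mul_of_nonneg_left hle (norm_nonneg _))
  have hfn : 0 < ‖f‖ := norm_pos_iff.2 hf0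
  nlinarith

theorem essSpectrum_assocOp_opS (hb : 0 < b) (hc : 0 < c) {K : L2 →L[ℂ] L2}
    (hK : IsCompactOperator K) (hKs : IsSelfAdjoint K) :
    UnboundedOp.essSpectrum (assocOp (opS hb hc) K) = specSet b c :=
  essSpectrum_assocOp (opS_injective hb hc) (denseRange_opS hb hc) hK hKs isClosed_specSet
    (fun _ => accPt_specSet) (fun _ => isUnit_pencil_opS hb hc) (injective_pencil_opS hb hc)
    (fun _ => not_isUnit_pencil_opS hb hc)

end HDot

/-! ### Auxiliary facts on Bochner integrals and extended nonnegative reals. -/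

open scoped ENNReal

/-- The Bochner integral of a function with values in a closed subspace lies in that subspace. -/
theorem Submodule.integral_mem_of_isClosed {α E : Type*} [MeasurableSpace α] {μ : Measure α}
    [NormedAddCommGroup E] [NormedSpace ℂ E] [CompleteSpace E] {W : Submodule ℂ E}
    (hW : IsClosed (W : Set E)) {f : α → E} (hf : Integrable f μ) (h : ∀ x, f x ∈ W) :
    ∫ x, f x ∂μ ∈ W := by
  have : CompleteSpace W := hW.completeSpace_coe
  set F : α → W := fun x => ⟨f x, h x⟩ with hF
  have hm : AEStronglyMeasurable F μ :=
    (Topology.IsEmbedding.subtypeVal.aestronglyMeasurable_comp_iff (f := F)).1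
      hf.aestronglyMeasurable
  have hFi : Integrable F μ := ⟨hm, hf.hasFiniteIntegral⟩
  have h1 : ∫ x, f x ∂μ = W.subtypeL (∫ x, F x ∂μ) :=
    ContinuousLinearMap.integral_comp_comm W.subtypeL hFi
  rw [h1]
  exact (∫ x, F x ∂μ).2

theorem ENNReal.add_sq_le_two_mul (x y : ℝ≥0∞) : (x + y) ^ 2 ≤ 2 * (x ^ 2 + y ^ 2) := by
  have h := ENNReal.rpow_add_le_mul_rpow_add_rpow x y (p := 2) one_le_two
  norm_num at h
  exact h

namespace HDot

open ContinuousLinearMap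

variable {b c : ℝ}

/-! ### Point evaluation on `H¹(ℝ)` -/

theorem memLp_expVec (hb : 0 < b) (hc : 0 < c) (x : ℝ) :
    MemLp (fun ξ : ℝ => Complex.exp (-(2 * Real.pi * x * ξ : ℝ) * Complex.I) * symW b c ξ) 2
      volume := by
  have hm : Continuous fun ξ : ℝ =>
      Complex.exp (-(2 * Real.pi * x * ξ : ℝ) * Complex.I) * symW b c ξ := by
    have := continuous_symW (c := c) hb
    fun_prop
  refine (memLp_two_symW hb hc).mono hm.aestronglyMeasurable (ae_of_all _ fun ξ => le_of_eq ?_)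
  rw [norm_mul, ← Complex.ofReal_neg, Complex.norm_exp_ofReal_mul_I, one_mul]

/-- The Fourier representation of the evaluation at `x`. -/
def expVec (hb : 0 < b) (hc : 0 < c) (x : ℝ) : L2 := (memLp_expVec hb hc x).toLp _

theorem integrable_mulOp_symW (hb : 0 < b) (hc : 0 < c) (f : L2) :
    Integrable (mulOp _ (memLp_symW hb (c := c)) f) volume := by
  have h : Integrable (fun ξ => (symW b c ξ : ℂ) * f ξ) volume :=
    (memLp_two_symW hb hc).integrable_mul (Lp.memLp f)
  exact h.congr (mulOp_ae _ f).symm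

theorem inner_expVec (hb : 0 < b) (hc : 0 < c) (x : ℝ) (f : L2) :
    inner ℂ (expVec hb hc x) f =
      𝓕⁻ (mulOp _ (memLp_symW hb (c := c)) f : ℝ → ℂ) x := by
  rw [L2.inner_def, Real.fourierInv_eq']
  refine integral_congr_ae ?_
  filter_upwards [(memLp_expVec hb hc x).coeFn_toLp, mulOp_ae (memLp_symW hb (c := c)) f]
    with ξ h1 h2
  rw [expVec, h1, h2, RCLike.inner_apply, map_mul, Complex.conj_ofReal, ← Complex.exp_conj,
    smul_eq_mul, map_mul, Complex.conj_I, map_neg, Complex.conj_ofReal]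
  have : -((2 * Real.pi * x * ξ : ℝ) : ℂ) * -Complex.I =
      ((2 * Real.pi * inner ℝ ξ x : ℝ) : ℂ) * Complex.I := by
    simp only [RCLike.inner_apply, conj_trivial]
    push_cast
    ring
  rw [this]
  ring

theorem toSobolevOne_ae (hb : 0 < b) (hc : 0 < c) (f : L2) :
    (toSobolevOne hb hc f : L2) =ᵐ[volume] fun x => inner ℂ (expVec hb hc x) f := by
  rw [coe_toSobolevOne]
  filter_upwards [fourierInv_coeFn (integrable_mulOp_symW hb hc f)] with x hx
  rw [hx, inner_expVec]

/-- The Gram function `⟪eₓ, e_y⟫` depends only on `x - y` and is the inverse Fourier transform of an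
integrable function, hence continuous; distances between the vectors are expressed through it. -/
theorem continuous_expVec (hb : 0 < b) (hc : 0 < c) : Continuous (expVec hb hc) := by
  set w : L2 := expVec hb hc 0 with hw
  set Φ : ℝ → ℂ := fun x => inner ℂ (expVec hb hc x) w with hΦ
  have hΦc : Continuous Φ := by
    have hL : Continuous fun p : ℝ × ℝ => (-innerₗ ℝ) p.1 p.2 := by
      have : Continuous fun p : ℝ × ℝ => -inner ℝ p.1 p.2 := continuous_inner.neg
      exact this
    have h1 : Continuous (𝓕⁻ (mulOp _ (memLp_symW hb (c := c)) w : ℝ → ℂ)) :=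
      VectorFourier.fourierIntegral_continuous Real.continuous_fourierChar hL
        (integrable_mulOp_symW hb hc w)
    refine h1.congr fun x => ?_
    rw [hΦ, ← inner_expVec]
  have hshift : ∀ x y, inner ℂ (expVec hb hc x) (expVec hb hc y) = Φ (x - y) := by
    intro x y
    simp only [hΦ, hw]
    rw [L2.inner_def, L2.inner_def]
    refine integral_congr_ae ?_
    filter_upwards [(memLp_expVec hb hc x).coeFn_toLp, (memLp_expVec hb hc y).coeFn_toLp,
      (memLp_expVec hb hc (x - y)).coeFn_toLp, (memLp_expVec hb hc 0).coeFn_toLp]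
      with ξ h1 h2 h3 h4
    simp only [expVec, h1, h2, h3, h4, RCLike.inner_apply, map_mul, Complex.conj_ofReal,
      ← Complex.exp_conj, Complex.conj_I, map_neg]
    have e1 : ∀ p q r s : ℂ, p * r * (q * s) = p * q * (r * s) := fun p q r s => by ring
    rw [e1, ← Complex.exp_add, e1, ← Complex.exp_add]
    congr 2
    push_cast
    ring
  rw [continuous_iff_continuousAt]
  intro x
  rw [ContinuousAt, tendsto_iff_norm_sub_tendsto_zero]
  have h1 : ∀ y, ‖expVec hb hc y - expVec hb hc x‖ = √(2 * (Φ 0).re - 2 * (Φ (y - x)).re) := by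
    intro y
    have h2 := norm_sub_sq (𝕜 := ℂ) (expVec hb hc y) (expVec hb hc x)
    have h3 : ∀ y, ‖expVec hb hc y‖ ^ 2 = (Φ 0).re := fun y => by
      rw [← sub_self y, ← hshift]
      exact norm_sq_eq_re_inner (𝕜 := ℂ) _
    rw [h3, h3, hshift] at h2
    rw [← Real.sqrt_sq (norm_nonneg (expVec hb hc y - expVec hb hc x)), h2]
    congr 1
    simp only [RCLike.re_to_complex]
    ring
  simp only [h1]
  have h4 : Continuous fun y => √(2 * (Φ 0).re - 2 * (Φ (y - x)).re) := by fun_prop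
  have h5 := h4.tendsto x
  simpa using h5

/-- The fundamental theorem of calculus in `H¹(ℝ)`. -/
theorem inner_expVec_sub (hb : 0 < b) (hc : 0 < c) (f : L2) {x y : ℝ} (hxy : x ≤ y) :
    inner ℂ (expVec hb hc y) f - inner ℂ (expVec hb hc x) f =
      ∫ s in Set.Ioc x y, (weakDeriv (toSobolevOne hb hc f) : L2) s := by
  have hfin : volume (Set.Ioc x y) ≠ ⊤ := measure_Ioc_lt_top.ne
  set e : L2 := indicatorConstLp 2 measurableSet_Ioc hfin (1 : ℂ) with he
  have hei : Integrable e volume :=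
    integrable_indicatorConstLp measurableSet_Ioc hfin 1
  -- The integral is the inner product with an indicator. Plancherel moves it to the Fourier side,
  -- where the transform of the indicator, a difference of exponentials over `-2πiξ`, cancels the
  -- factor `iλ` of the derivative.
  rw [← L2.inner_indicatorConstLp_one (𝕜 := ℂ) measurableSet_Ioc hfin, ← he,
    weakDeriv_toSobolevOne, ← Lp.inner_fourier_eq e, FourierTransform.fourier_fourierInv_eq,
    ← inner_sub_left, L2.inner_def, L2.inner_def]
  refine integral_congr_ae ?_
  filter_upwards [fourier_coeFn hei, mulOp_ae (memLp_symD hb hc) f, ae_ne_zero,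
    (memLp_expVec hb hc x).coeFn_toLp, (memLp_expVec hb hc y).coeFn_toLp,
    Lp.coeFn_sub (expVec hb hc y) (expVec hb hc x)] with ξ h1 h2 h0 h3 h4 h5
  have h6 : 𝓕 (e : ℝ → ℂ) ξ = ∫ v in x..y, Complex.exp (-(2 * Real.pi * ξ * Complex.I) * v) := by
    rw [Real.fourier_eq', intervalIntegral.integral_of_le hxy, ← integral_indicator
      measurableSet_Ioc]
    refine integral_congr_ae ?_
    filter_upwards [indicatorConstLp_coeFn (p := 2) (hs := measurableSet_Ioc) (hμs := hfin)
      (c := (1 : ℂ))] with v hv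
    rw [he, hv]
    by_cases hvs : v ∈ Set.Ioc x y
    · rw [Set.indicator_of_mem hvs, Set.indicator_of_mem hvs, smul_eq_mul, mul_one]
      congr 1
      simp only [RCLike.inner_apply, conj_trivial]
      push_cast
      ring
    · rw [Set.indicator_of_notMem hvs, Set.indicator_of_notMem hvs, smul_zero]
  have hne : -(2 * (Real.pi : ℂ) * ξ * Complex.I) ≠ 0 := by
    have h7 : (ξ : ℂ) ≠ 0 := Complex.ofReal_ne_zero.2 h0
    have h8 : (Real.pi : ℂ) ≠ 0 := Complex.ofReal_ne_zero.2 Real.pi_ne_zero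
    simp [h7, h8]
  rw [integral_exp_mul_complex hne] at h6
  rw [h1, h2, h5, Pi.sub_apply, expVec, expVec, h3, h4, h6]
  simp only [RCLike.inner_apply, map_sub, map_mul, map_div₀, map_neg, Complex.conj_ofReal,
    ← Complex.exp_conj, Complex.conj_I, symD, map_ofNat]
  have e1 : ∀ t : ℝ, -((2 * Real.pi * t * ξ : ℝ) : ℂ) * -Complex.I =
      -(2 * (Real.pi : ℂ) * ξ * -Complex.I) * t := fun t => by push_cast; ring
  rw [e1, e1]
  have hξ : (ξ : ℂ) ≠ 0 := Complex.ofReal_ne_zero.2 h0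
  field_simp

/-! ### Bounds for potentials -/

theorem lintegral_enorm_sq (g : L2) : ∫⁻ x, ‖g x‖ₑ ^ 2 = ‖g‖ₑ ^ 2 := by
  have h := eLpNorm_nnreal_pow_eq_lintegral (μ := (volume : Measure ℝ)) (f := g) (p := 2)
    two_ne_zero
  simp only [NNReal.coe_ofNat, ENNReal.rpow_ofNat] at h
  rw [← h, Lp.enorm_def]
  rfl

/-- The constant in the Sobolev inequality. -/
def sobolevConst (hb : 0 < b) (hc : 0 < c) : ℝ≥0∞ :=
  2 * (‖mulOp _ (memLp_symW hb (c := c))‖ₑ ^ 2 + ‖mulOp _ (memLp_symD hb hc)‖ₑ ^ 2)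

theorem sobolevConst_ne_top (hb : 0 < b) (hc : 0 < c) : sobolevConst hb hc ≠ ⊤ := by
  unfold sobolevConst
  finiteness

/-- The Sobolev inequality in an interval of length one. -/
theorem enorm_inner_expVec_sq_le (hb : 0 < b) (hc : 0 < c) (f : L2) (n : ℤ) {x : ℝ}
    (hx : x ∈ Set.Ioc (n : ℝ) (n + 1)) :
    ‖inner ℂ (expVec hb hc x) f‖ₑ ^ 2 ≤
      ∫⁻ y in Set.Ioc (n : ℝ) (n + 1), 2 * (‖(toSobolevOne hb hc f : L2) y‖ₑ ^ 2 +
        ‖(weakDeriv (toSobolevOne hb hc f) : L2) y‖ₑ ^ 2) := by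
  set I : Set ℝ := Set.Ioc (n : ℝ) (n + 1) with hI
  set ψ : L2 := weakDeriv (toSobolevOne hb hc f) with hψ
  have hvol : volume I = 1 := by simp [hI]
  have hprob : IsProbabilityMeasure (volume.restrict I) :=
    ⟨by rw [Measure.restrict_apply_univ, hvol]⟩
  have hmψ : AEMeasurable (fun y => ‖ψ y‖ₑ) (volume.restrict I) :=
    (Lp.aestronglyMeasurable ψ).enorm.restrict
  have hmφ : AEMeasurable (fun y => ‖(toSobolevOne hb hc f : L2) y‖ₑ) (volume.restrict I) :=
    (Lp.aestronglyMeasurable _).enorm.restrict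
  -- Cauchy–Schwarz on an interval of length one, where Lebesgue measure is a probability measure.
  have hJ : (∫⁻ s in I, ‖ψ s‖ₑ) ^ 2 ≤ ∫⁻ s in I, ‖ψ s‖ₑ ^ 2 := by
    have h := eLpNorm_le_eLpNorm_of_exponent_le (μ := volume.restrict I) (f := ψ)
      (one_le_two : (1 : ℝ≥0∞) ≤ 2) (Lp.aestronglyMeasurable ψ).restrict
    rw [eLpNorm_one_eq_lintegral_enorm] at h
    have h2 := eLpNorm_nnreal_pow_eq_lintegral (μ := volume.restrict I) (f := ψ) (p := 2)
      two_ne_zero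
    simp only [NNReal.coe_ofNat, ENNReal.rpow_ofNat] at h2
    rw [← h2]
    exact pow_le_pow_left' h 2
  have hdiff : ∀ y ∈ I, ‖inner ℂ (expVec hb hc x) f‖ₑ ≤
      ‖inner ℂ (expVec hb hc y) f‖ₑ + ∫⁻ s in I, ‖ψ s‖ₑ := by
    have key : ∀ p ∈ I, ∀ q ∈ I, p ≤ q →
        ‖inner ℂ (expVec hb hc q) f - inner ℂ (expVec hb hc p) f‖ₑ ≤ ∫⁻ s in I, ‖ψ s‖ₑ := by
      intro p hp q hq hpq
      rw [inner_expVec_sub hb hc f hpq]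
      refine (enorm_integral_le_lintegral_enorm _).trans (lintegral_mono_set ?_)
      exact Set.Ioc_subset_Ioc hp.1.le hq.2
    intro y hy
    have h1 : inner ℂ (expVec hb hc x) f = inner ℂ (expVec hb hc y) f +
        (inner ℂ (expVec hb hc x) f - inner ℂ (expVec hb hc y) f) := by ring
    rw [h1]
    refine (enorm_add_le _ _).trans (add_le_add_right ?_ _)
    rcases le_total y x with h | h
    · exact key y hy x hx h
    · rw [enorm_sub_rev]
      exact key x hx y hy h
  -- The left side does not depend on `y`, so it equals its average over `y ∈ I`; each `|u(x)|` is
  -- compared with `|u(y)|` by the fundamental theorem of calculus.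
  calc ‖inner ℂ (expVec hb hc x) f‖ₑ ^ 2
      = ∫⁻ _ in I, ‖inner ℂ (expVec hb hc x) f‖ₑ ^ 2 := by
        rw [setLIntegral_const, hvol, mul_one]
    _ ≤ ∫⁻ y in I, 2 * (‖(toSobolevOne hb hc f : L2) y‖ₑ ^ 2 + ∫⁻ s in I, ‖ψ s‖ₑ ^ 2) := by
        refine lintegral_mono_ae ?_
        filter_upwards [ae_restrict_of_ae (toSobolevOne_ae hb hc f),
          ae_restrict_mem measurableSet_Ioc] with y hy hyI
        rw [hy]
        refine (pow_le_pow_left' (hdiff y hyI) 2).trans ((ENNReal.add_sq_le_two_mul _ _).trans ?_)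
        gcongr
    _ = ∫⁻ y in I, 2 * (‖(toSobolevOne hb hc f : L2) y‖ₑ ^ 2 + ‖ψ y‖ₑ ^ 2) := by
        rw [lintegral_const_mul' _ _ (by norm_num), lintegral_const_mul' _ _ (by norm_num),
          lintegral_add_left' (hmφ.pow_const 2), lintegral_add_left' (hmφ.pow_const 2),
          setLIntegral_const, hvol, mul_one]

/-- On each unit interval `|u|²` is bounded by the local `H¹` norm, leaving only the integral of `W`
there. Summing the local norms gives the global one, so only the unit-interval integrals of `W`
matter. -/
theorem lintegral_potential_le (hb : 0 < b) (hc : 0 < c) (f : L2) {W : ℝ → ℝ≥0∞}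
    (hW : AEMeasurable W volume) {M : ℝ≥0∞}
    (hM : ∀ n : ℤ, ∫⁻ x in Set.Ioc (n : ℝ) (n + 1), W x ≤ M) :
    ∫⁻ x, W x * ‖inner ℂ (expVec hb hc x) f‖ₑ ^ 2 ≤ M * (sobolevConst hb hc * ‖f‖ₑ ^ 2) := by
  set u : L2 := (toSobolevOne hb hc f : L2) with hu
  set ψ : L2 := weakDeriv (toSobolevOne hb hc f) with hψ
  have hsum : ∀ F : ℝ → ℝ≥0∞, ∫⁻ x, F x = ∑' n : ℤ, ∫⁻ x in Set.Ioc (n : ℝ) (n + 1), F x := by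
    intro F
    rw [← lintegral_iUnion (fun _ => measurableSet_Ioc) (Set.pairwise_disjoint_Ioc_intCast ℝ),
      iUnion_Ioc_intCast, Measure.restrict_univ]
  have hme : AEMeasurable (fun y => ‖u y‖ₑ ^ 2) volume :=
    (Lp.aestronglyMeasurable u).enorm.pow_const 2
  calc ∫⁻ x, W x * ‖inner ℂ (expVec hb hc x) f‖ₑ ^ 2
      = ∑' n : ℤ, ∫⁻ x in Set.Ioc (n : ℝ) (n + 1), W x * ‖inner ℂ (expVec hb hc x) f‖ₑ ^ 2 :=
        hsum _
    _ ≤ ∑' n : ℤ, M * ∫⁻ y in Set.Ioc (n : ℝ) (n + 1), 2 * (‖u y‖ₑ ^ 2 + ‖ψ y‖ₑ ^ 2) := by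
        refine ENNReal.tsum_le_tsum fun n => ?_
        calc ∫⁻ x in Set.Ioc (n : ℝ) (n + 1), W x * ‖inner ℂ (expVec hb hc x) f‖ₑ ^ 2
            ≤ ∫⁻ x in Set.Ioc (n : ℝ) (n + 1),
                W x * ∫⁻ y in Set.Ioc (n : ℝ) (n + 1), 2 * (‖u y‖ₑ ^ 2 + ‖ψ y‖ₑ ^ 2) := by
              refine setLIntegral_mono' measurableSet_Ioc fun x hx => ?_
              gcongr
              exact enorm_inner_expVec_sq_le hb hc f n hx
          _ = (∫⁻ x in Set.Ioc (n : ℝ) (n + 1), W x) *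
                ∫⁻ y in Set.Ioc (n : ℝ) (n + 1), 2 * (‖u y‖ₑ ^ 2 + ‖ψ y‖ₑ ^ 2) :=
              lintegral_mul_const'' _ hW.restrict
          _ ≤ _ := by
              gcongr
              exact hM n
    _ = M * (2 * (‖u‖ₑ ^ 2 + ‖ψ‖ₑ ^ 2)) := by
        rw [ENNReal.tsum_mul_left, ← hsum, lintegral_const_mul' _ _ (by norm_num),
          lintegral_add_left' hme, lintegral_enorm_sq, lintegral_enorm_sq]
    _ ≤ M * (sobolevConst hb hc * ‖f‖ₑ ^ 2) := by
        have h1 : ‖u‖ₑ = ‖mulOp _ (memLp_symW hb (c := c)) f‖ₑ := by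
          rw [hu, coe_toSobolevOne, ← ofReal_norm, ← ofReal_norm, ← Lp.norm_fourier_eq,
            FourierTransform.fourier_fourierInv_eq]
        have h2 : ‖ψ‖ₑ = ‖mulOp _ (memLp_symD hb hc) f‖ₑ := by
          rw [hψ, weakDeriv_toSobolevOne, ← ofReal_norm, ← ofReal_norm, ← Lp.norm_fourier_eq,
            FourierTransform.fourier_fourierInv_eq]
        rw [h1, h2, sobolevConst, mul_assoc, add_mul, ← mul_pow, ← mul_pow]
        gcongr
        · exact (mulOp _ (memLp_symW hb (c := c))).le_opENorm f
        · exact (mulOp _ (memLp_symD hb hc)).le_opENorm f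

end HDot

/-- Test with the multiple of `T g` that has the same norm as `g`. The hypothesis is stated with a
sum of squares because pointwise `2|u||v| ≤ |u|² + |v|²` produces that form under an integral. -/
theorem ContinuousLinearMap.opNorm_le_of_norm_inner_le {G : Type*} [NormedAddCommGroup G]
    [InnerProductSpace ℂ G] {T : G →L[ℂ] G} {C : ℝ} (hC : 0 ≤ C)
    (h : ∀ f g : G, 2 * ‖inner ℂ f (T g)‖ ≤ C * (‖f‖ ^ 2 + ‖g‖ ^ 2)) : ‖T‖ ≤ C := by
  refine T.opNorm_le_bound hC fun g => ?_
  rcases eq_or_ne (T g) 0 with h0 | h0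
  · rw [h0, norm_zero]
    positivity
  have hT : 0 < ‖T g‖ := norm_pos_iff.2 h0
  have hg : 0 < ‖g‖ := norm_pos_iff.2 fun hg => h0 (by rw [hg, map_zero])
  have h1 := h (((‖g‖ / ‖T g‖ : ℝ) : ℂ) • T g) g
  have h2 : ‖((‖g‖ / ‖T g‖ : ℝ) : ℂ) • T g‖ = ‖g‖ := by
    rw [norm_smul, Complex.norm_real, Real.norm_of_nonneg (by positivity),
      div_mul_cancel₀ _ hT.ne']
  have h3 : ‖inner ℂ (((‖g‖ / ‖T g‖ : ℝ) : ℂ) • T g) (T g)‖ = ‖g‖ * ‖T g‖ := by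
    rw [inner_smul_left, norm_mul, RCLike.norm_conj, Complex.norm_real,
      Real.norm_of_nonneg (by positivity), inner_self_eq_norm_sq_to_K, norm_pow, RCLike.norm_ofReal,
      abs_of_pos hT]
    field_simp
  rw [h2, h3] at h1
  nlinarith

theorem two_mul_enorm_mul_enorm_le (x y : ℂ) : 2 * (‖x‖ₑ * ‖y‖ₑ) ≤ ‖x‖ₑ ^ 2 + ‖y‖ₑ ^ 2 := by
  have h : 2 * (‖x‖₊ * ‖y‖₊) ≤ ‖x‖₊ ^ 2 + ‖y‖₊ ^ 2 := by
    rw [← mul_assoc]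
    exact two_mul_le_add_sq _ _
  simp only [enorm_eq_nnnorm]
  exact_mod_cast h

namespace HDot

open ContinuousLinearMap InnerProductSpace

variable {b c : ℝ}

/-! ### The operator of an integrable potential -/

theorem norm_expVec_le (hb : 0 < b) (hc : 0 < c) (x : ℝ) :
    ‖expVec hb hc x‖ ≤ ‖expVec hb hc 0‖ := by
  refine Lp.norm_le_norm_of_ae_le ?_
  filter_upwards [(memLp_expVec hb hc x).coeFn_toLp, (memLp_expVec hb hc 0).coeFn_toLp]
    with ξ h1 h2
  rw [expVec, expVec, h1, h2, norm_mul, norm_mul, ← Complex.ofReal_neg, ← Complex.ofReal_neg,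
    Complex.norm_exp_ofReal_mul_I, Complex.norm_exp_ofReal_mul_I]

/-- The operator of the form `∫ V conj(u) v` in the Fourier representation. -/
def potOp (hb : 0 < b) (hc : 0 < c) (V : ℝ → ℝ) : L2 →L[ℂ] L2 :=
  ∫ x, (V x : ℂ) • rankOne ℂ (expVec hb hc x) (expVec hb hc x)

theorem integrable_potOp (hb : 0 < b) (hc : 0 < c) {V : ℝ → ℝ} (hV : Integrable V volume) :
    Integrable (fun x => (V x : ℂ) • rankOne ℂ (expVec hb hc x) (expVec hb hc x)) volume := by
  have hcont : Continuous fun x => rankOne ℂ (expVec hb hc x) (expVec hb hc x) := by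
    have := continuous_expVec hb hc
    exact (smulRightL ℂ L2 L2).continuous₂.comp (((innerSL ℂ).continuous.comp this).prodMk this)
  refine (hV.norm.mul_const (‖expVec hb hc 0‖ * ‖expVec hb hc 0‖)).mono'
    ((Complex.continuous_ofReal.comp_aestronglyMeasurable hV.aestronglyMeasurable).smul
      hcont.aestronglyMeasurable) (ae_of_all _ fun x => ?_)
  rw [norm_smul, Complex.norm_real, norm_rankOne]
  gcongr <;> exact norm_expVec_le hb hc x

/-- The integrand is rank one, and the compact operators form a closed subspace, which contains the
Bochner integral. -/
theorem isCompactOperator_potOp (hb : 0 < b) (hc : 0 < c) {V : ℝ → ℝ}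
    (hV : Integrable V volume) : IsCompactOperator (potOp hb hc V) := by
  refine Submodule.integral_mem_of_isClosed (W := compactOperator (RingHom.id ℂ) L2 L2)
    isClosed_setOfPred_isCompactOperator (integrable_potOp hb hc hV) fun x => ?_
  refine Submodule.smul_mem _ _ ?_
  change IsCompactOperator (rankOne ℂ (expVec hb hc x) (expVec hb hc x))
  rw [rankOne_def']
  exact (isCompactOperator_of_locallyCompactSpace_dom (innerSL ℂ (expVec hb hc x))).clm_comp
    (ContinuousLinearMap.toSpanSingleton ℂ (expVec hb hc x))

theorem inner_potOp (hb : 0 < b) (hc : 0 < c) {V : ℝ → ℝ} (hV : Integrable V volume)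
    (f g : L2) : inner ℂ f (potOp hb hc V g) =
      ∫ x, (V x : ℂ) * (conj (inner ℂ (expVec hb hc x) f) * inner ℂ (expVec hb hc x) g) := by
  have hi := integrable_potOp hb hc hV
  rw [potOp, ContinuousLinearMap.integral_apply hi,
    ← integral_inner (hi.apply_continuousLinearMap g)]
  refine integral_congr_ae (ae_of_all _ fun x => ?_)
  simp only [smul_apply, rankOne_apply, inner_smul_right, inner_conj_symm]
  ring

theorem inner_potOp_eq (hb : 0 < b) (hc : 0 < c) {V : ℝ → ℝ} (hV : Integrable V volume)
    (f g : L2) : inner ℂ f (potOp hb hc V g) =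
      ∫ x, (V x : ℂ) * (conj ((toSobolevOne hb hc f : L2) x) * (toSobolevOne hb hc g : L2) x) := by
  rw [inner_potOp hb hc hV]
  refine integral_congr_ae ?_
  filter_upwards [toSobolevOne_ae hb hc f, toSobolevOne_ae hb hc g] with x h1 h2
  rw [h1, h2]

theorem potOp_sub (hb : 0 < b) (hc : 0 < c) {V W : ℝ → ℝ} (hV : Integrable V volume)
    (hW : Integrable W volume) :
    potOp hb hc V - potOp hb hc W = potOp hb hc (V - W) := by
  rw [potOp, potOp, potOp, ← integral_sub (integrable_potOp hb hc hV) (integrable_potOp hb hc hW)]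
  simp only [Pi.sub_apply, Complex.ofReal_sub, sub_smul]

/-- The bound involves the integrals over unit intervals instead of the full `L¹` norm, so it
applies uniformly to truncations of a potential that need not be integrable on the line. -/
theorem norm_potOp_le (hb : 0 < b) (hc : 0 < c) {V : ℝ → ℝ} (hV : Integrable V volume) {M : ℝ}
    (hM0 : 0 ≤ M) (hM : ∀ n : ℤ, ∫⁻ x in Set.Ioc (n : ℝ) (n + 1), ‖V x‖ₑ ≤ ENNReal.ofReal M) :
    ‖potOp hb hc V‖ ≤ M * (sobolevConst hb hc).toReal := by
  refine opNorm_le_of_norm_inner_le (by positivity) fun f g => ?_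
  have hVm : AEMeasurable (fun x => ‖V x‖ₑ) volume := hV.aestronglyMeasurable.enorm
  have hm : ∀ f : L2, AEMeasurable (fun x => ‖inner ℂ (expVec hb hc x) f‖ₑ ^ 2) volume := fun f =>
    (((continuous_expVec hb hc).inner continuous_const).enorm.measurable.pow_const 2).aemeasurable
  have h1 : 2 * ‖inner ℂ f (potOp hb hc V g)‖ₑ ≤
      ENNReal.ofReal M * (sobolevConst hb hc * ‖f‖ₑ ^ 2) +
        ENNReal.ofReal M * (sobolevConst hb hc * ‖g‖ₑ ^ 2) := by
    calc 2 * ‖inner ℂ f (potOp hb hc V g)‖ₑ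
        ≤ 2 * ∫⁻ x, ‖V x‖ₑ * (‖inner ℂ (expVec hb hc x) f‖ₑ * ‖inner ℂ (expVec hb hc x) g‖ₑ) := by
          rw [inner_potOp hb hc hV]
          gcongr
          refine (enorm_integral_le_lintegral_enorm _).trans (le_of_eq ?_)
          refine lintegral_congr fun x => ?_
          rw [enorm_mul, enorm_mul, RCLike.enorm_conj, ← ofReal_norm (V x : ℂ),
            Complex.norm_real, ofReal_norm]
      _ = ∫⁻ x, ‖V x‖ₑ *
            (2 * (‖inner ℂ (expVec hb hc x) f‖ₑ * ‖inner ℂ (expVec hb hc x) g‖ₑ)) := by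
          rw [← lintegral_const_mul' _ _ (by norm_num)]
          refine lintegral_congr fun x => ?_
          ring
      _ ≤ ∫⁻ x, (‖V x‖ₑ * ‖inner ℂ (expVec hb hc x) f‖ₑ ^ 2 +
            ‖V x‖ₑ * ‖inner ℂ (expVec hb hc x) g‖ₑ ^ 2) := by
          refine lintegral_mono fun x => ?_
          rw [← mul_add]
          gcongr
          exact two_mul_enorm_mul_enorm_le _ _
      _ ≤ _ := by
          have hmf : AEMeasurable (fun x => ‖V x‖ₑ * ‖inner ℂ (expVec hb hc x) f‖ₑ ^ 2) volume :=
            hVm.mul (hm f)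
          rw [lintegral_add_left' hmf]
          exact add_le_add (lintegral_potential_le hb hc f hVm hM)
            (lintegral_potential_le hb hc g hVm hM)
  have hC := sobolevConst_ne_top hb hc
  have h2 := ENNReal.toReal_mono (by finiteness) h1
  rw [ENNReal.toReal_add (by finiteness) (by finiteness)] at h2
  simp only [ENNReal.toReal_mul, ENNReal.toReal_pow, toReal_enorm, ENNReal.toReal_ofReal hM0,
    ENNReal.toReal_ofNat] at h2
  linarith

/-! ### The operator of a potential which vanishes at infinity -/

section Potential

variable {V : ℝ → ℝ}

theorem exists_lintegral_tail_le (hV : LocallyIntegrable V volume)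
    (hV₀ : Tendsto (fun x : ℝ => ∫ s in x..(x + 1), |V s|) (cocompact ℝ) (𝓝 0)) {ε : ℝ}
    (hε : 0 < ε) :
    ∃ N : ℕ, ∀ n : ℤ, (N : ℤ) ≤ |n| →
      ∫⁻ x in Set.Ioc (n : ℝ) (n + 1), ‖V x‖ₑ ≤ ENNReal.ofReal ε := by
  have h1 := hV₀.eventually (gt_mem_nhds hε)
  rw [← Metric.cobounded_eq_cocompact,
    (Metric.hasBasis_cobounded_compl_closedBall (0 : ℝ)).eventually_iff] at h1
  obtain ⟨R, -, hR⟩ := h1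
  obtain ⟨N, hN⟩ := exists_nat_gt R
  refine ⟨N, fun n hn => ?_⟩
  have hn' : (n : ℝ) ∈ (Metric.closedBall (0 : ℝ) R)ᶜ := by
    rw [Set.mem_compl_iff, Metric.mem_closedBall, dist_zero_right, not_le, Real.norm_eq_abs]
    have : ((N : ℤ) : ℝ) ≤ ((|n| : ℤ) : ℝ) := by exact_mod_cast hn
    rw [Int.cast_abs, Int.cast_natCast] at this
    exact hN.trans_le this
  have h2 := hR hn'
  have hint : IntegrableOn V (Set.Ioc (n : ℝ) (n + 1)) volume :=
    (hV.integrableOn_isCompact isCompact_Icc).mono_set Set.Ioc_subset_Icc_self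
  rw [← ofReal_integral_norm_eq_lintegral_enorm hint]
  refine ENNReal.ofReal_le_ofReal ?_
  rw [intervalIntegral.integral_of_le (by linarith)] at h2
  exact h2.le

theorem exists_lintegral_unit_le (hV : LocallyIntegrable V volume)
    (hV₀ : Tendsto (fun x : ℝ => ∫ s in x..(x + 1), |V s|) (cocompact ℝ) (𝓝 0)) :
    ∃ M : ℝ≥0∞, M ≠ ⊤ ∧ ∀ n : ℤ, ∫⁻ x in Set.Ioc (n : ℝ) (n + 1), ‖V x‖ₑ ≤ M := by
  obtain ⟨N, hN⟩ := exists_lintegral_tail_le hV hV₀ one_pos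
  have hint : IntegrableOn V (Set.Ioc (-(N : ℝ)) N) volume :=
    (hV.integrableOn_isCompact isCompact_Icc).mono_set Set.Ioc_subset_Icc_self
  refine ⟨ENNReal.ofReal 1 + ∫⁻ x in Set.Ioc (-(N : ℝ)) N, ‖V x‖ₑ,
    ENNReal.add_ne_top.2 ⟨by finiteness, hint.2.ne⟩, fun n => ?_⟩
  rcases le_or_gt (N : ℤ) |n| with h | h
  · exact (hN n h).trans le_self_add
  · refine le_trans (lintegral_mono_set ?_) le_add_self
    rw [abs_lt] at h
    have h1 : -(N : ℝ) ≤ n := by exact_mod_cast h.1.le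
    -- For integers `n < N` means `n + 1 ≤ N`, so the whole interval `(n, n + 1]` lies in `(-N, N]`.
    have h2 : (n : ℝ) + 1 ≤ N := by exact_mod_cast h.2
    exact Set.Ioc_subset_Ioc h1 h2

theorem integrable_potential (hb : 0 < b) (hc : 0 < c) (hV : LocallyIntegrable V volume)
    (hV₀ : Tendsto (fun x : ℝ => ∫ s in x..(x + 1), |V s|) (cocompact ℝ) (𝓝 0)) (f : L2) :
    Integrable (fun x => V x * ‖(toSobolevOne hb hc f : L2) x‖ ^ 2) volume := by
  obtain ⟨M, hM, hMn⟩ := exists_lintegral_unit_le hV hV₀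
  refine ⟨hV.aestronglyMeasurable.mul ((Lp.aestronglyMeasurable _).norm.pow 2), ?_⟩
  have h1 := lintegral_potential_le hb hc f hV.aestronglyMeasurable.enorm hMn
  rw [hasFiniteIntegral_iff_enorm]
  have h2 : ∫⁻ x, ‖V x * ‖(toSobolevOne hb hc f : L2) x‖ ^ 2‖ₑ =
      ∫⁻ x, ‖V x‖ₑ * ‖inner ℂ (expVec hb hc x) f‖ₑ ^ 2 := by
    refine lintegral_congr_ae ?_
    filter_upwards [toSobolevOne_ae hb hc f] with x hx
    rw [hx, enorm_mul, enorm_pow, enorm_norm]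
  rw [h2]
  have hC := sobolevConst_ne_top hb hc
  exact h1.trans_lt (by finiteness)

/-- The truncation of `V` to `(-N, N]`. -/
def truncPot (V : ℝ → ℝ) (N : ℕ) : ℝ → ℝ := (Set.Ioc (-(N : ℝ)) N).indicator V

theorem integrable_truncPot (hV : LocallyIntegrable V volume) (N : ℕ) :
    Integrable (truncPot V N) volume :=
  ((hV.integrableOn_isCompact isCompact_Icc).mono_set
    Set.Ioc_subset_Icc_self).integrable_indicator measurableSet_Ioc

theorem truncPot_of_mem {N : ℕ} {x : ℝ} (h : x ∈ Set.Ioc (-(N : ℝ)) N) :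
    truncPot V N x = V x := Set.indicator_of_mem h V

theorem enorm_truncPot_sub_le (N M : ℕ) (x : ℝ) :
    ‖truncPot V N x - truncPot V M x‖ₑ ≤ ‖V x‖ₑ := by
  unfold truncPot
  by_cases h1 : x ∈ Set.Ioc (-(N : ℝ)) N <;> by_cases h2 : x ∈ Set.Ioc (-(M : ℝ)) M <;>
    simp [Set.indicator, h1, h2]

/-- The difference of two truncations vanishes on the unit intervals inside the smaller window and
is dominated by `|V|` on the remaining ones, where the unit integrals are small. -/
theorem cauchySeq_potOp (hb : 0 < b) (hc : 0 < c) (hV : LocallyIntegrable V volume)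
    (hV₀ : Tendsto (fun x : ℝ => ∫ s in x..(x + 1), |V s|) (cocompact ℝ) (𝓝 0)) :
    CauchySeq fun N : ℕ => potOp hb hc (truncPot V N) := by
  rw [Metric.cauchySeq_iff']
  intro ε hε
  set C := (sobolevConst hb hc).toReal with hC
  have hC0 : 0 ≤ C := ENNReal.toReal_nonneg
  -- The threshold is chosen so that its product with the Sobolev constant `C` is below `ε`; the `+
  -- 1` covers `C = 0`.
  obtain ⟨N, hN⟩ := exists_lintegral_tail_le hV hV₀ (ε := ε / (2 * (C + 1))) (by positivity)
  refine ⟨N, fun M hM => ?_⟩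
  rw [dist_eq_norm, potOp_sub hb hc (integrable_truncPot hV M) (integrable_truncPot hV N)]
  have h1 := norm_potOp_le hb hc ((integrable_truncPot hV M).sub (integrable_truncPot hV N))
    (M := ε / (2 * (C + 1))) (by positivity) fun n => by
      rcases le_or_gt (N : ℤ) |n| with h | h
      · exact (lintegral_mono fun x => enorm_truncPot_sub_le M N x).trans (hN n h)
      · rw [abs_lt] at h
        have h1 : -(N : ℝ) ≤ n := by exact_mod_cast h.1.le
        have h2 : (n : ℝ) + 1 ≤ N := by exact_mod_cast h.2
        have h3 : (N : ℝ) ≤ M := by exact_mod_cast hM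
        have h4 : ∫⁻ x in Set.Ioc (n : ℝ) (n + 1), ‖(truncPot V M - truncPot V N) x‖ₑ = 0 := by
          rw [setLIntegral_congr_fun (g := fun _ => 0) measurableSet_Ioc, lintegral_zero]
          intro x hx
          have h5 : x ∈ Set.Ioc (-(N : ℝ)) N := Set.Ioc_subset_Ioc h1 h2 hx
          have h6 : x ∈ Set.Ioc (-(M : ℝ)) M := Set.Ioc_subset_Ioc (by linarith) h3 h5
          simp only [Pi.sub_apply, truncPot_of_mem h5, truncPot_of_mem h6, sub_self, enorm_zero]
        rw [h4]
        exact zero_le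
  refine h1.trans_lt ?_
  rw [← hC, div_mul_eq_mul_div, div_lt_iff₀ (by positivity)]
  nlinarith

/-- The form `∫ V conj(u) v` on `H¹(ℝ)` is given by a compact operator. -/
theorem exists_compact_potential (hb : 0 < b) (hc : 0 < c) (hV : LocallyIntegrable V volume)
    (hV₀ : Tendsto (fun x : ℝ => ∫ s in x..(x + 1), |V s|) (cocompact ℝ) (𝓝 0)) :
    ∃ K : L2 →L[ℂ] L2, IsCompactOperator K ∧ IsSelfAdjoint K ∧ ∀ f g : L2,
      inner ℂ f (K g) =
        ∫ x, (V x : ℂ) *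
          (conj ((toSobolevOne hb hc f : L2) x) * (toSobolevOne hb hc g : L2) x) := by
  obtain ⟨K, hK⟩ := cauchySeq_tendsto_of_complete (cauchySeq_potOp hb hc hV hV₀)
  have hform : ∀ f g : L2, inner ℂ f (K g) =
      ∫ x, (V x : ℂ) *
        (conj ((toSobolevOne hb hc f : L2) x) * (toSobolevOne hb hc g : L2) x) := by
    intro f g
    have h1 : Tendsto (fun N : ℕ => inner ℂ f (potOp hb hc (truncPot V N) g)) atTop
        (𝓝 (inner ℂ f (K g))) := by
      have h2 : Tendsto (fun N : ℕ => potOp hb hc (truncPot V N) g) atTop (𝓝 (K g)) :=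
        ((ContinuousLinearMap.apply ℂ L2 g).continuous.tendsto K).comp hK
      exact tendsto_const_nhds.inner h2
    refine tendsto_nhds_unique h1 ?_
    simp only [inner_potOp_eq hb hc (integrable_truncPot hV _)]
    have hint := integrable_mul_of_sq hV (integrable_potential hb hc hV hV₀ f)
      (integrable_potential hb hc hV hV₀ g)
    -- The limit operator still represents the full potential: `|V u v|` dominates all truncated
    -- integrands and is integrable by the Sobolev bound.
    refine tendsto_integral_of_dominated_convergence _ (fun N => ?_) hint.norm (fun N => ?_) ?_
    · have h1 : AEStronglyMeasurable (fun x => (truncPot V N x : ℂ)) volume :=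
        Complex.continuous_ofReal.comp_aestronglyMeasurable
          (integrable_truncPot hV N).aestronglyMeasurable
      have h2 : AEStronglyMeasurable (fun x => conj ((toSobolevOne hb hc f : L2) x)) volume :=
        Complex.continuous_conj.comp_aestronglyMeasurable (Lp.aestronglyMeasurable _)
      exact h1.mul (h2.mul (Lp.aestronglyMeasurable _))
    · refine ae_of_all _ fun x => ?_
      rw [norm_mul, norm_mul (V x : ℂ), Complex.norm_real, Complex.norm_real]
      gcongr
      exact norm_indicator_le_norm_self V x
    · refine ae_of_all _ fun x => ?_
      refine tendsto_const_nhds.congr' ?_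
      obtain ⟨N, hN⟩ := exists_nat_gt |x|
      filter_upwards [eventually_ge_atTop N] with M hM
      have h3 : |x| < M := hN.trans_le (by exact_mod_cast hM)
      rw [truncPot_of_mem ⟨(abs_lt.1 h3).1, (abs_lt.1 h3).2.le⟩]
  refine ⟨K, isCompactOperator_of_tendsto hK (Eventually.of_forall fun N =>
    isCompactOperator_potOp hb hc (integrable_truncPot hV N)), ?_, hform⟩
  rw [ContinuousLinearMap.isSelfAdjoint_iff_isSymmetric]
  intro f g
  change inner ℂ (K f) g = inner ℂ f (K g)
  rw [← inner_conj_symm, hform, hform, ← integral_conj]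
  refine integral_congr_ae (ae_of_all _ fun x => ?_)
  simp only [map_mul, Complex.conj_ofReal, Complex.conj_conj]
  ring

end Potential

/-! ### The forms in the Fourier representation -/

theorem _root_.SesqForm.ofInjective_form {F H : Type*} [AddCommGroup F] [Module ℂ F]
    [NormedAddCommGroup H] [InnerProductSpace ℂ H] (f : F →ₗ[ℂ] H) (hf : Function.Injective f)
    (B : F →ₗ⋆[ℂ] F →ₗ[ℂ] ℂ) (u v : F) (hu : f u ∈ (SesqForm.ofInjective f hf B).domain)
    (hv : f v ∈ (SesqForm.ofInjective f hf B).domain) :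
    (SesqForm.ofInjective f hf B).form ⟨f u, hu⟩ ⟨f v, hv⟩ = B u v := by
  have h : ∀ (u : F) (hu : f u ∈ LinearMap.range f),
      (LinearEquiv.ofInjective f hf).symm ⟨f u, hu⟩ = u := fun u hu => by
    rw [LinearEquiv.symm_apply_eq]
    rfl
  change B ((LinearEquiv.ofInjective f hf).symm ⟨f u, hu⟩)
    ((LinearEquiv.ofInjective f hf).symm ⟨f v, hv⟩) = B u v
  exact congrArg₂ (fun u v => B u v) (h u hu) (h v hv)

theorem exists_opS_eq (hb : 0 < b) (hc : 0 < c) (u : sobolevOne) :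
    ∃ f, opS hb hc f = embOne u := by
  obtain ⟨f, rfl⟩ := toSobolevOne_surjective hb hc u
  exact ⟨f, rfl⟩

/-- By Plancherel this is the symbol identity `(c²λ² + b²) w² = 1` for `w = symW`: the
parametrization is unitary from `L²` onto `H¹` with the inner product `𝔱₀`. -/
theorem inner_weakDeriv_add (hb : 0 < b) (hc : 0 < c) (f g : L2) :
    (c : ℂ) ^ 2 * inner ℂ (weakDeriv (toSobolevOne hb hc f)) (weakDeriv (toSobolevOne hb hc g)) +
      (b : ℂ) ^ 2 * inner ℂ (toSobolevOne hb hc f : L2) (toSobolevOne hb hc g : L2) =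
      inner ℂ f g := by
  rw [weakDeriv_toSobolevOne, weakDeriv_toSobolevOne, coe_toSobolevOne, coe_toSobolevOne,
    ← Lp.inner_fourier_eq, ← Lp.inner_fourier_eq (𝓕⁻ (mulOp _ (memLp_symW hb (c := c)) f))]
  simp only [FourierTransform.fourier_fourierInv_eq]
  rw [← inner_smul_right, ← inner_smul_right, L2.inner_def, L2.inner_def, L2.inner_def,
    ← integral_add (L2.integrable_inner _ _) (L2.integrable_inner _ _)]
  refine integral_congr_ae ?_
  filter_upwards [mulOp_ae (memLp_symW hb (c := c)) f, mulOp_ae (memLp_symW hb (c := c)) g,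
    mulOp_ae (memLp_symD hb hc) f, mulOp_ae (memLp_symD hb hc) g,
    Lp.coeFn_smul ((c : ℂ) ^ 2) (mulOp _ (memLp_symD hb hc) g),
    Lp.coeFn_smul ((b : ℂ) ^ 2) (mulOp _ (memLp_symW hb (c := c)) g)] with ξ h1 h2 h3 h4 h5 h6
  have h7 : symD b c ξ * conj (symD b c ξ) = ((absFreq ξ * symW b c ξ) ^ 2 : ℝ) := by
    rw [RCLike.mul_conj, norm_symD hb]
    norm_cast
  have h8 : (c : ℂ) ^ 2 * (absFreq ξ * symW b c ξ) ^ 2 + (b : ℂ) ^ 2 * (symW b c ξ) ^ 2 = 1 := by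
    have := symW_sq_mul (c := c) hb ξ
    have h9 : c ^ 2 * (absFreq ξ * symW b c ξ) ^ 2 + b ^ 2 * (symW b c ξ) ^ 2 = 1 := by
      linear_combination this
    exact_mod_cast h9
  push_cast at h7
  rw [h5, h6, Pi.smul_apply, Pi.smul_apply, h1, h2, h3, h4]
  simp only [RCLike.inner_apply, smul_eq_mul, map_mul, Complex.conj_ofReal]
  linear_combination (c : ℂ) ^ 2 * (g ξ * conj (f ξ)) * h7 + (g ξ * conj (f ξ)) * h8

theorem isPencilForm_formT₀ (hb : 0 < b) (hc : 0 < c) :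
    (formT₀ b c).IsPencilForm (opS hb hc) 0 where
  mem_domain f := ⟨toSobolevOne hb hc f, rfl⟩
  exists_eq := by
    rintro _ ⟨u, rfl⟩
    exact exists_opS_eq hb hc u
  form_eq f g := by
    rw [zero_apply, add_zero, ← inner_weakDeriv_add hb hc]
    exact SesqForm.ofInjective_form embOne embOne_injective _ (toSobolevOne hb hc f)
      (toSobolevOne hb hc g) _ _

section Potential

variable {V : ℝ → ℝ}

theorem opS_mem_domain_formQ (hb : 0 < b) (hc : 0 < c) (hV : LocallyIntegrable V volume)
    (hV₀ : Tendsto (fun x : ℝ => ∫ s in x..(x + 1), |V s|) (cocompact ℝ) (𝓝 0)) (f : L2) :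
    opS hb hc f ∈ (formQ V hV).domain :=
  ⟨⟨toSobolevOne hb hc f, integrable_potential hb hc hV hV₀ f⟩, rfl⟩

theorem formQ_opS (hb : 0 < b) (hc : 0 < c) (hV : LocallyIntegrable V volume)
    (hV₀ : Tendsto (fun x : ℝ => ∫ s in x..(x + 1), |V s|) (cocompact ℝ) (𝓝 0)) (f g : L2)
    (hf : opS hb hc f ∈ (formQ V hV).domain) (hg : opS hb hc g ∈ (formQ V hV).domain) :
    (formQ V hV).form ⟨opS hb hc f, hf⟩ ⟨opS hb hc g, hg⟩ =
      ∫ x, (V x : ℂ) *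
        (conj ((toSobolevOne hb hc f : L2) x) * (toSobolevOne hb hc g : L2) x) :=
  SesqForm.ofInjective_form (embOne ∘ₗ (domQ V hV).subtype)
    (embOne_injective.comp (domQ V hV).injective_subtype) _
    (⟨toSobolevOne hb hc f, integrable_potential hb hc hV hV₀ f⟩ : domQ V hV)
    (⟨toSobolevOne hb hc g, integrable_potential hb hc hV hV₀ g⟩ : domQ V hV) hf hg

theorem isPencilForm_formT (hb : 0 < b) (hc : 0 < c) (hV : LocallyIntegrable V volume)
    (hV₀ : Tendsto (fun x : ℝ => ∫ s in x..(x + 1), |V s|) (cocompact ℝ) (𝓝 0))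
    {K : L2 →L[ℂ] L2} (hK : ∀ f g : L2, inner ℂ f (K g) =
      ∫ x, (V x : ℂ) *
        (conj ((toSobolevOne hb hc f : L2) x) * (toSobolevOne hb hc g : L2) x)) :
    (formT b c V hV).IsPencilForm (opS hb hc) K where
  mem_domain f := ⟨(isPencilForm_formT₀ hb hc).mem_domain f, opS_mem_domain_formQ hb hc hV hV₀ f⟩
  exists_eq u hu := (isPencilForm_formT₀ hb hc).exists_eq u hu.1
  form_eq f g := by
    have h := (isPencilForm_formT₀ hb hc).form_eq f g
    rw [zero_apply, add_zero] at h
    rw [inner_add_right, hK, ← h, ← formQ_opS hb hc hV hV₀ f g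
      (opS_mem_domain_formQ hb hc hV hV₀ f) (opS_mem_domain_formQ hb hc hV hV₀ g)]
    rfl

/-- Here `𝔱₀` is `‖f‖²` and `𝔮_V` is `⟪f, K f⟫`, so compactness of `K` together with injectivity of
`S` gives any relative bound `a > 0`. -/
theorem isInfinitesimallyBounded_formQ (hb : 0 < b) (hc : 0 < c) (hV : LocallyIntegrable V volume)
    (hV₀ : Tendsto (fun x : ℝ => ∫ s in x..(x + 1), |V s|) (cocompact ℝ) (𝓝 0))
    {K : L2 →L[ℂ] L2} (hKc : IsCompactOperator K) (hK : ∀ f g : L2, inner ℂ f (K g) =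
      ∫ x, (V x : ℂ) *
        (conj ((toSobolevOne hb hc f : L2) x) * (toSobolevOne hb hc g : L2) x)) :
    (formQ V hV).IsInfinitesimallyBounded (formT₀ b c) := by
  have ht := isPencilForm_formT₀ hb hc
  refine ⟨fun u hu => ?_, fun a ha => ?_⟩
  · obtain ⟨f, rfl⟩ := ht.exists_eq u hu
    exact opS_mem_domain_formQ hb hc hV hV₀ f
  · obtain ⟨β, hβ, h⟩ := hKc.exists_norm_inner_le (opS_injective hb hc) ha
    refine ⟨β, hβ, fun u => ?_⟩
    obtain ⟨f, rfl⟩ := ht.exists_eq_mk u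
    have h1 := formQ_opS hb hc hV hV₀ f f (opS_mem_domain_formQ hb hc hV hV₀ f)
      (opS_mem_domain_formQ hb hc hV hV₀ f)
    rw [← hK] at h1
    refine le_trans (le_of_eq (congrArg norm h1)) ((h f).trans (le_of_eq ?_))
    rw [ht.form_eq, zero_apply, add_zero, inner_self_eq_norm_sq_to_K]
    norm_cast

end Potential

end HDot

/-! ### The main theorem: the pencils `(S, K)` and `(S, 0)` compared. -/

theorem mainTheorem6 (b c : ℝ) (hb : 0 < b) (hc : 0 < c) (V : ℝ → ℝ)
    (hV : LocallyIntegrable V volume)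
    (hV₀ : Tendsto (fun x : ℝ => ∫ s in x..(x + 1), |V s|) (cocompact ℝ) (𝓝 0)) :
    (HDot.formQ V hV).IsInfinitesimallyBounded (HDot.formT₀ b c) ∧
    (HDot.formT b c V hV).IsClosed ∧
    (HDot.formT b c V hV).IsLowerSemibounded ∧
    ∃ L : HDot.HDotHalf →ₗ.[ℂ] HDot.HDotHalf,
      (HDot.formT b c V hV).IsAssociatedOperator L ∧
      IsSelfAdjoint L ∧
      (∀ (z : ℂ) (R R₀ : HDot.HDotHalf →L[ℂ] HDot.HDotHalf),
        UnboundedOp.IsResolventAt L z R →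
        UnboundedOp.IsResolventAt (HDot.opL₀ b c) z R₀ → IsCompactOperator (R - R₀)) ∧
      UnboundedOp.essSpectrum L = UnboundedOp.essSpectrum (HDot.opL₀ b c) ∧
      UnboundedOp.essSpectrum (HDot.opL₀ b c) =
        (fun r : ℝ => (r : ℂ)) '' Set.Ici (2 * b * c) := by
  obtain ⟨K, hKc, hKs, hK⟩ := HDot.exists_compact_potential hb hc hV hV₀
  have hi := HDot.opS_injective hb hc
  have hd := HDot.denseRange_opS hb hc
  have ht := HDot.isPencilForm_formT hb hc hV hV₀ hK
  have h₀ : UnboundedOp.essSpectrum (HDot.opL₀ b c) = HDot.specSet b c := by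
    rw [HDot.opL₀_eq_assocOp hb hc]
    exact HDot.essSpectrum_assocOp_opS hb hc isCompactOperator_zero (IsSelfAdjoint.zero _)
  refine ⟨HDot.isInfinitesimallyBounded_formQ hb hc hV hV₀ hKc hK, ht.isClosed hi hKc,
    ht.isLowerSemibounded hi hKc hKs, assocOp (HDot.opS hb hc) K, ht.isAssociatedOperator hi hd,
    isSelfAdjoint_assocOp hi hd hKc hKs, fun z R R₀ hR hR₀ => ?_, ?_, h₀⟩
  · rw [HDot.opL₀_eq_assocOp hb hc] at hR₀
    exact isCompactOperator_resolvent_sub hi hd hKc hR hR₀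
  · rw [h₀]
    exact HDot.essSpectrum_assocOp_opS hb hc hKc hKs

end
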